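/- Let $M$ be a connected smooth $n$-manifold (without boundary, not necessarily compact), $g$ a smooth Riemannian metric on $M$, $\mathcal{L}$ a principal $U(1)$-bundle over $M$, and $A$ a smooth connection on $\mathcal{L}$. Identify the Lie algebra of $U(1)$ with $\mathbb{R}$, so that the curvature $F$ of $A$ is a real-valued $2$-form on $M$. Put $\eta_{ij}=g^{kl}F_{ik}F_{jl}$ and $|F|^2=g^{ij}g^{kl}F_{ik}F_{jl}$, and let $d^*$ be the codifferential, $(d^*F)_j=-g^{ki}\nabla_kF_{ij}$. Suppose that $(M,\mathcal{L},g,F,\lambda)$ is an Einstein Yang--Mills system, i.e. that for a constant $\lambda\in\mathbb{R}$ $$\mathrm{Ric}-\tfrac12\,\eta=\lambda g,\qquad d^*F=0 .$$ Then the scalar curvature $R$ of $g$ and the function $|F|^2$ are constant on $M$. -/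

import Mathlib

open scoped Manifold ContDiff Bundle

namespace EYM

/-! ### Smooth differential forms of degree one and two -/

section Forms

variable (n : ℕ) (M : Type*) [TopologicalSpace M] [ChartedSpace (EuclideanSpace ℝ (Fin n)) M]
  [IsManifold (𝓡 n) ∞ M]

/-- A smooth real-valued 1-form: a smooth section of the cotangent bundle. -/
structure OneForm where
  /-- The value of the form at a point. -/
  val (x : M) : TangentSpace (𝓡 n) x →L[ℝ] ℝ
  smooth : ContMDiff (𝓡 n) ((𝓡 n).prod 𝓘(ℝ, EuclideanSpace ℝ (Fin n) →L[ℝ] ℝ)) ∞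
    (fun x ↦ Bundle.TotalSpace.mk' (EuclideanSpace ℝ (Fin n) →L[ℝ] ℝ)
      (E := fun x : M ↦ TangentSpace (𝓡 n) x →L[ℝ] ℝ) x (val x))

/-- A smooth real-valued 2-form: a smooth field of alternating bilinear forms on the tangent
spaces. -/
structure TwoForm where
  /-- The value of the form at a point. -/
  val (x : M) : TangentSpace (𝓡 n) x →L[ℝ] TangentSpace (𝓡 n) x →L[ℝ] ℝ
  alternating (x : M) (v : TangentSpace (𝓡 n) x) : val x v v = 0
  smooth : ContMDiff (𝓡 n)
    ((𝓡 n).prod 𝓘(ℝ, EuclideanSpace ℝ (Fin n) →L[ℝ] EuclideanSpace ℝ (Fin n) →L[ℝ] ℝ)) ∞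
    (fun x ↦ Bundle.TotalSpace.mk'
      (EuclideanSpace ℝ (Fin n) →L[ℝ] EuclideanSpace ℝ (Fin n) →L[ℝ] ℝ)
      (E := fun x : M ↦ TangentSpace (𝓡 n) x →L[ℝ] TangentSpace (𝓡 n) x →L[ℝ] ℝ) x (val x))

/-- A smooth Riemannian metric on `M`. -/
abbrev Metric :=
  Bundle.ContMDiffRiemannianMetric (𝓡 n) ∞ (EuclideanSpace ℝ (Fin n))
    (fun x : M ↦ TangentSpace (𝓡 n) x)

/-- The local coordinate systems of `M`: all charts of the maximal smooth atlas. -/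
abbrev charts : Set (OpenPartialHomeomorph M (EuclideanSpace ℝ (Fin n))) :=
  IsManifold.maximalAtlas (𝓡 n) ∞ M

end Forms

/-! ### Tensor calculus in local coordinates

A coordinate system `e` is a chart; the point with coordinates `u` is `e.symm u`. All coordinate
expressions below are functions of `u`, and are meaningful for `u ∈ e.target`. -/

section Coordinates

variable {n : ℕ} {M : Type*} [TopologicalSpace M] [ChartedSpace (EuclideanSpace ℝ (Fin n)) M]
  [IsManifold (𝓡 n) ∞ M]

/-- The partial derivative `∂ᵢ f` of a function of the coordinates. -/
noncomputable def partialDeriv (i : Fin n) (f : EuclideanSpace ℝ (Fin n) → ℝ)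
    (u : EuclideanSpace ℝ (Fin n)) : ℝ :=
  fderiv ℝ f u (EuclideanSpace.single i 1)

/-- The tangent vector at the point `e.symm u` whose components in the coordinates `e` are
those of `v`. -/
noncomputable def tangentVec (e : OpenPartialHomeomorph M (EuclideanSpace ℝ (Fin n)))
    (u v : EuclideanSpace ℝ (Fin n)) : TangentSpace (𝓡 n) (e.symm u) :=
  mfderiv (𝓡 n) (𝓡 n) e.symm u v

/-- The coordinate vector field `∂ᵢ` at the point `e.symm u`. -/
noncomputable def coordVec (e : OpenPartialHomeomorph M (EuclideanSpace ℝ (Fin n)))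
    (i : Fin n) (u : EuclideanSpace ℝ (Fin n)) : TangentSpace (𝓡 n) (e.symm u) :=
  tangentVec e u (EuclideanSpace.single i 1)

/-- The exterior derivative of a 1-form `α`, evaluated at the point `e.symm u` on the tangent
vectors with components `v` and `w`: `(dα)(v, w) = ∂ᵥ (α(w)) - ∂_w (α(v))`, where `v` and `w`
are extended with constant components. -/
noncomputable def extDerivOneForm (α : OneForm n M)
    (e : OpenPartialHomeomorph M (EuclideanSpace ℝ (Fin n)))
    (u v w : EuclideanSpace ℝ (Fin n)) : ℝ :=
  fderiv ℝ (fun y ↦ α.val (e.symm y) (tangentVec e y w)) u v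
    - fderiv ℝ (fun y ↦ α.val (e.symm y) (tangentVec e y v)) u w

variable (g : Metric n M) (F : TwoForm n M)
  (e : OpenPartialHomeomorph M (EuclideanSpace ℝ (Fin n)))

/-- The components `gᵢⱼ` of the metric. -/
noncomputable def metricCoord (u : EuclideanSpace ℝ (Fin n)) : Matrix (Fin n) (Fin n) ℝ :=
  Matrix.of fun i j ↦ g.inner (e.symm u) (coordVec e i u) (coordVec e j u)

/-- The components `gⁱʲ` of the inverse metric. -/
noncomputable def invMetricCoord (u : EuclideanSpace ℝ (Fin n)) : Matrix (Fin n) (Fin n) ℝ :=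
  (metricCoord g e u)⁻¹

/-- The Christoffel symbols of the Levi-Civita connection,
`Γᵏᵢⱼ = ½ gᵏˡ (∂ᵢ gⱼₗ + ∂ⱼ gᵢₗ - ∂ₗ gᵢⱼ)`. -/
noncomputable def christoffel (k i j : Fin n) (u : EuclideanSpace ℝ (Fin n)) : ℝ :=
  (1 / 2) * ∑ l, invMetricCoord g e u k l *
    (partialDeriv i (fun y ↦ metricCoord g e y j l) u
      + partialDeriv j (fun y ↦ metricCoord g e y i l) u
      - partialDeriv l (fun y ↦ metricCoord g e y i j) u)

/-- The components of the curvature tensor of the Levi-Civita connection: the coefficient of `∂ₗ`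
in `Rm(∂ᵢ, ∂ⱼ) ∂ₖ = ∇ᵢ ∇ⱼ ∂ₖ - ∇ⱼ ∇ᵢ ∂ₖ`. -/
noncomputable def riemannCoord (l k i j : Fin n) (u : EuclideanSpace ℝ (Fin n)) : ℝ :=
  partialDeriv i (christoffel g e l j k) u - partialDeriv j (christoffel g e l i k) u
    + ∑ m, (christoffel g e l i m u * christoffel g e m j k u
      - christoffel g e l j m u * christoffel g e m i k u)

/-- The components `Rⱼₖ` of the Ricci tensor, `Ric(Y, Z) = tr (X ↦ Rm(X, Y) Z)`. -/
noncomputable def ricciCoord (j k : Fin n) (u : EuclideanSpace ℝ (Fin n)) : ℝ :=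
  ∑ i, riemannCoord g e i k i j u

/-- The scalar curvature `gⁱʲ Rᵢⱼ` at a point `x`, computed in the coordinates `e`. -/
noncomputable def scalarCurvature (x : M) : ℝ :=
  ∑ i, ∑ j, invMetricCoord g e (e x) i j * ricciCoord g e i j (e x)

/-- The components `Fᵢⱼ` of a 2-form. -/
noncomputable def formCoord (i j : Fin n) (u : EuclideanSpace ℝ (Fin n)) : ℝ :=
  F.val (e.symm u) (coordVec e i u) (coordVec e j u)

/-- The components `ηᵢⱼ = gᵏˡ Fᵢₖ Fⱼₗ`. -/
noncomputable def etaCoord (i j : Fin n) (u : EuclideanSpace ℝ (Fin n)) : ℝ :=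
  ∑ k, ∑ l, invMetricCoord g e u k l * formCoord F e i k u * formCoord F e j l u

/-- The squared norm `|F|² = gⁱʲ gᵏˡ Fᵢₖ Fⱼₗ` at a point `x`, computed in the coordinates `e`. -/
noncomputable def formNormSq (x : M) : ℝ :=
  ∑ i, ∑ j, ∑ k, ∑ l, invMetricCoord g e (e x) i j * invMetricCoord g e (e x) k l
    * formCoord F e i k (e x) * formCoord F e j l (e x)

/-- The components `∇ₖ Fᵢⱼ = ∂ₖ Fᵢⱼ - Γˡₖᵢ Fₗⱼ - Γˡₖⱼ Fᵢₗ` of the covariant derivative of a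
2-form. -/
noncomputable def covDerivForm (k i j : Fin n) (u : EuclideanSpace ℝ (Fin n)) : ℝ :=
  partialDeriv k (formCoord F e i j) u
    - ∑ l, christoffel g e l k i u * formCoord F e l j u
    - ∑ l, christoffel g e l k j u * formCoord F e i l u

/-- The components `(d*F)ⱼ = - gᵏⁱ ∇ₖ Fᵢⱼ` of the codifferential of a 2-form. -/
noncomputable def codiffCoord (j : Fin n) (u : EuclideanSpace ℝ (Fin n)) : ℝ :=
  - ∑ k, ∑ i, invMetricCoord g e u k i * covDerivForm g F e k i j u

end Coordinates

/-! ### Principal `U(1)`-bundles, connections and curvature -/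

section Bundles

variable {n : ℕ} {M : Type*} [TopologicalSpace M] [ChartedSpace (EuclideanSpace ℝ (Fin n)) M]
  [IsManifold (𝓡 n) ∞ M]
  {P : Type*} [TopologicalSpace P] [ChartedSpace (EuclideanSpace ℝ (Fin (n + 1))) P]
  [IsManifold (𝓡 (n + 1)) ∞ P] [MulAction Circle P]

/-- `proj : P → M` is a smooth principal `U(1)`-bundle: the circle acts smoothly on `P`, and over
a neighbourhood `U` of each point of `M` there is a smooth equivariant trivialization
`proj⁻¹(U) ≅ U × U(1)` over `U`. (As `U(1)` is commutative, left and right actions agree.) -/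
structure IsPrincipalCircleBundle (proj : P → M) : Prop where
  smooth_action : ContMDiffSMul (𝓡 1) (𝓡 (n + 1)) ∞ Circle P
  locally_trivial : ∀ x : M, ∃ (U : Set M) (φ : OpenPartialHomeomorph P (M × Circle)),
    IsOpen U ∧ x ∈ U ∧ φ.source = proj ⁻¹' U ∧ φ.target = U ×ˢ Set.univ ∧
    ContMDiffOn (𝓡 (n + 1)) ((𝓡 n).prod (𝓡 1)) ∞ φ φ.source ∧
    ContMDiffOn ((𝓡 n).prod (𝓡 1)) (𝓡 (n + 1)) ∞ φ.symm φ.target ∧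
    (∀ p ∈ φ.source, (φ p).1 = proj p) ∧
    (∀ p ∈ φ.source, ∀ z : Circle, z • p ∈ φ.source ∧ φ (z • p) = ((φ p).1, z * (φ p).2))

/-- `A` is the connection form of a connection on the principal `U(1)`-bundle `P`, the Lie algebra
of `U(1)` being identified with `ℝ` through `t ↦ exp (i t)`: it is invariant and takes the value
`1` on the generator of the action. -/
structure IsConnectionForm (A : OneForm (n + 1) P) : Prop where
  invariant : ∀ (z : Circle) (p : P) (v : TangentSpace (𝓡 (n + 1)) p),
    A.val (z • p) (mfderiv (𝓡 (n + 1)) (𝓡 (n + 1)) (fun q : P ↦ z • q) p v) = A.val p v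
  generator : ∀ p : P, A.val (Circle.exp 0 • p)
    (mfderiv 𝓘(ℝ, ℝ) (𝓡 (n + 1)) (fun t : ℝ ↦ Circle.exp t • p) 0 (1 : ℝ)) = 1

/-- The 2-form `F` on the base is the curvature of the connection `A`: `proj* F = dA`. -/
def IsCurvature (proj : P → M) (A : OneForm (n + 1) P) (F : TwoForm n M) : Prop :=
  ∀ e ∈ charts (n + 1) P, ∀ u ∈ e.target, ∀ v w : EuclideanSpace ℝ (Fin (n + 1)),
    F.val (proj (e.symm u))
        (mfderiv (𝓡 (n + 1)) (𝓡 n) proj (e.symm u) (tangentVec e u v))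
        (mfderiv (𝓡 (n + 1)) (𝓡 n) proj (e.symm u) (tangentVec e u w))
      = extDerivOneForm A e u v w

/-- Einstein Yang-Mills systems: `proj : P → M` is a principal `U(1)`-bundle, `A` a connection on it
with curvature `F`, and `Ric - ½ η = lam g`, `d*F = 0` hold in all local coordinates. -/
structure IsEYMSystem (proj : P → M) (g : Metric n M) (A : OneForm (n + 1) P) (F : TwoForm n M)
    (lam : ℝ) : Prop where
  bundle : IsPrincipalCircleBundle (n := n) proj
  connection : IsConnectionForm A
  curvature : IsCurvature proj A F
  einstein : ∀ e ∈ charts n M, ∀ u ∈ e.target, ∀ i j : Fin n,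
    ricciCoord g e i j u - (1 / 2) * etaCoord g F e i j u = lam * metricCoord g e u i j
  yangMills : ∀ e ∈ charts n M, ∀ u ∈ e.target, ∀ j : Fin n, codiffCoord g F e j u = 0

end Bundles

end EYM

/-! The proof compares the divergence of the Einstein equation with its trace. At a given point,
take coordinates with `gᵢⱼ = δᵢⱼ` and `∂ₖ gᵢⱼ = 0` there, so that covariant derivatives are partial
derivatives, and put `Sₘ = ∑ Fᵢₖ ∂ₘ Fᵢₖ = ½ ∂ₘ|F|²`. The contracted second Bianchi identity says `∂ᵢ
Rᵢₘ = ½ ∂ₘ R`.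

On the left, `Rᵢₘ = ½ ηᵢₘ + λ gᵢₘ` and `∂ᵢ ηᵢₘ = (∂ᵢ Fᵢₖ) Fₘₖ + Fᵢₖ ∂ᵢ Fₘₖ`. The first term vanishes
because `d*F = 0`; antisymmetry and `dF = 0` turn the second into `½ Sₘ`. So the left side is `¼
Sₘ`. On the right, the trace `R = ½ |F|² + λ n` gives `½ Sₘ`. Hence `Sₘ = 0` in every dimension,
`|F|²` is locally constant, and connectedness finishes the argument; the trace equation then gives
`R`.

The computation is `IsNormalAt.sum_formCoord_mul_partialDeriv`, resting on
`IsNormalAt.contracted_bianchi`. The identity `dF = 0` comes from the bundle: pulling `A` back along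
a local section gives a potential of `F` (`IsCurvature.exists_potential`). First-order normal
coordinates (`exists_isNormalAt`) come from a linear and then a quadratic substitution, with no use
of geodesics. Each point has its own normal chart, so `formNormSq_eq`, the chart independence of
`|F|²`, is what makes the pointwise results fit together. -/

namespace EYM

/-! ### Calculus of partial derivatives -/

section PartialDeriv

variable {n : ℕ} {f h : EuclideanSpace ℝ (Fin n) → ℝ} {u : EuclideanSpace ℝ (Fin n)}
  {U : Set (EuclideanSpace ℝ (Fin n))}

theorem differentiableAt_of_contDiffOn (hU : IsOpen U) (hf : ContDiffOn ℝ ∞ f U) (hu : u ∈ U) :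
    DifferentiableAt ℝ f u :=
  (hf.contDiffAt (hU.mem_nhds hu)).differentiableAt (by simp)

theorem contDiffOn_partialDeriv (hU : IsOpen U) (hf : ContDiffOn ℝ ∞ f U) (i : Fin n) :
    ContDiffOn ℝ ∞ (partialDeriv i f) U :=
  (hf.fderiv_of_isOpen hU (m := ∞) (by simp)).clm_apply contDiffOn_const

theorem partialDeriv_congr (i : Fin n) (hfh : f =ᶠ[nhds u] h) :
    partialDeriv i f u = partialDeriv i h u := by
  simp only [partialDeriv, hfh.fderiv_eq]

theorem partialDeriv_congr_of_eqOn (hU : IsOpen U) (hu : u ∈ U) (i : Fin n)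
    (hfh : ∀ y ∈ U, f y = h y) : partialDeriv i f u = partialDeriv i h u :=
  partialDeriv_congr i (Filter.eventually_of_mem (hU.mem_nhds hu) hfh)

theorem partialDeriv_const (i : Fin n) (c : ℝ) : partialDeriv i (fun _ ↦ c) u = 0 := by
  simp [partialDeriv]

theorem partialDeriv_add (i : Fin n) (hf : DifferentiableAt ℝ f u) (hh : DifferentiableAt ℝ h u) :
    partialDeriv i (fun y ↦ f y + h y) u = partialDeriv i f u + partialDeriv i h u := by
  simp [partialDeriv, fderiv_fun_add hf hh]

theorem partialDeriv_sub (i : Fin n) (hf : DifferentiableAt ℝ f u) (hh : DifferentiableAt ℝ h u) :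
    partialDeriv i (fun y ↦ f y - h y) u = partialDeriv i f u - partialDeriv i h u := by
  simp [partialDeriv, fderiv_fun_sub hf hh]

theorem partialDeriv_mul (i : Fin n) (hf : DifferentiableAt ℝ f u) (hh : DifferentiableAt ℝ h u) :
    partialDeriv i (fun y ↦ f y * h y) u
      = partialDeriv i f u * h u + f u * partialDeriv i h u := by
  simp [partialDeriv, fderiv_fun_mul hf hh]; ring

theorem partialDeriv_const_mul (i : Fin n) (c : ℝ) (hf : DifferentiableAt ℝ f u) :
    partialDeriv i (fun y ↦ c * f y) u = c * partialDeriv i f u := by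
  simp [partialDeriv, fderiv_const_mul hf]

theorem partialDeriv_sum {ι : Type*} (s : Finset ι) (i : Fin n)
    {a : ι → EuclideanSpace ℝ (Fin n) → ℝ} (ha : ∀ j ∈ s, DifferentiableAt ℝ (a j) u) :
    partialDeriv i (fun y ↦ ∑ j ∈ s, a j y) u = ∑ j ∈ s, partialDeriv i (a j) u := by
  simp [partialDeriv, fderiv_fun_sum ha]

theorem partialDeriv_comm (hU : IsOpen U) (hf : ContDiffOn ℝ ∞ f U) (hu : u ∈ U) (i j : Fin n) :
    partialDeriv i (partialDeriv j f) u = partialDeriv j (partialDeriv i f) u := by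
  have hd : DifferentiableAt ℝ (fderiv ℝ f) u :=
    ((hf.fderiv_of_isOpen hU (m := ∞) (by simp)).contDiffAt (hU.mem_nhds hu)).differentiableAt
      (by simp)
  have key : ∀ a b : Fin n, partialDeriv a (partialDeriv b f) u
      = fderiv ℝ (fderiv ℝ f) u (EuclideanSpace.single a 1) (EuclideanSpace.single b 1) := by
    intro a b
    change fderiv ℝ (fun y ↦ fderiv ℝ f y (EuclideanSpace.single b 1)) u _ = _
    rw [fderiv_clm_apply hd (differentiableAt_const _)]
    simp
  rw [key, key]
  exact ((hf.contDiffAt (hU.mem_nhds hu)).isSymmSndFDerivAt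
    (by simpa using WithTop.coe_le_coe.2 (le_top : (2 : ℕ∞) ≤ ⊤))).eq _ _

theorem fderiv_eq_sum_partialDeriv (v : EuclideanSpace ℝ (Fin n)) :
    fderiv ℝ f u v = ∑ i, v i * partialDeriv i f u := by
  conv_lhs => rw [← (EuclideanSpace.basisFun (Fin n) ℝ).sum_repr v]
  simp [partialDeriv, map_sum]

/-- Every other Leibniz term contains a first derivative of `f` or the value of `h` at `u`. It is
meant for the products of `gᵏˡ` with first derivatives of the metric that make up the Christoffel
symbols. -/
theorem partialDeriv_mul_of_factor_eq_zero (hU : IsOpen U) (hf : ContDiffOn ℝ ∞ f U)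
    (hh : ContDiffOn ℝ ∞ h U) (hu : u ∈ U) (i j : Fin n) (hf1 : ∀ k, partialDeriv k f u = 0)
    (h0 : h u = 0) :
    partialDeriv i (partialDeriv j (fun y ↦ f y * h y)) u
      = f u * partialDeriv i (partialDeriv j h) u := by
  have hf' := contDiffOn_partialDeriv hU hf j
  have hh' := contDiffOn_partialDeriv hU hh j
  rw [partialDeriv_congr_of_eqOn hU hu i (fun y hy ↦ partialDeriv_mul j
      (differentiableAt_of_contDiffOn hU hf hy) (differentiableAt_of_contDiffOn hU hh hy)),
    partialDeriv_add i
      (differentiableAt_of_contDiffOn hU (hf'.mul hh) hu)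
      (differentiableAt_of_contDiffOn hU (hf.mul hh') hu),
    partialDeriv_mul i (differentiableAt_of_contDiffOn hU hf' hu)
      (differentiableAt_of_contDiffOn hU hh hu),
    partialDeriv_mul i (differentiableAt_of_contDiffOn hU hf hu)
      (differentiableAt_of_contDiffOn hU hh' hu)]
  simp [hf1, h0]

end PartialDeriv

/-! ### Smoothness and positivity of components in a chart -/

section Smoothness

variable {n : ℕ} {M : Type*} [TopologicalSpace M] [ChartedSpace (EuclideanSpace ℝ (Fin n)) M]
  [IsManifold (𝓡 n) ∞ M] {e : OpenPartialHomeomorph M (EuclideanSpace ℝ (Fin n))}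
  {u : EuclideanSpace ℝ (Fin n)}

omit [IsManifold (𝓡 n) ∞ M] in
theorem mdifferentiableAt_symm (he : e ∈ charts n M) (hu : u ∈ e.target) :
    MDifferentiableAt (𝓡 n) (𝓡 n) e.symm u :=
  (contMDiffAt_symm_of_mem_maximalAtlas he hu).mdifferentiableAt (by simp)

omit [IsManifold (𝓡 n) ∞ M] in
theorem tangentVec_sum_smul {ι : Type*} (s : Finset ι) (c : ι → ℝ)
    (v : ι → EuclideanSpace ℝ (Fin n)) :
    tangentVec e u (∑ i ∈ s, c i • v i) = ∑ i ∈ s, c i • tangentVec e u (v i) := by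
  have h := map_sum (mfderiv (𝓡 n) (𝓡 n) e.symm u) (fun i ↦ c i • v i) s
  exact h.trans (Finset.sum_congr rfl fun i _ ↦
    (mfderiv (𝓡 n) (𝓡 n) e.symm u).map_smul (c i) (v i))

/-- The field is the tangent map of `e.symm` composed with the constant section `v` of the tangent
bundle of Euclidean space. -/
theorem contMDiffOn_tangentVec (he : e ∈ charts n M) (v : EuclideanSpace ℝ (Fin n)) :
    ContMDiffOn (𝓡 n) (𝓡 n).tangent ∞
      (fun y ↦ Bundle.TotalSpace.mk' (EuclideanSpace ℝ (Fin n))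
        (E := fun x : M ↦ TangentSpace (𝓡 n) x) (e.symm y) (tangentVec e y v)) e.target := by
  have h1 := (contMDiffOn_symm_of_mem_maximalAtlas he).contMDiffOn_tangentMapWithin (m := ∞)
    (by simp) e.open_target.uniqueMDiffOn
  have h2 : ContMDiff (𝓡 n) (𝓡 n).tangent ∞ (fun y : EuclideanSpace ℝ (Fin n) ↦
      (⟨y, v⟩ : TangentBundle (𝓡 n) (EuclideanSpace ℝ (Fin n)))) := by
    intro y
    refine Bundle.contMDiffAt_totalSpace.2 ⟨contMDiffAt_id, ?_⟩
    simp only [mfld_simps]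
    exact contMDiffAt_const
  refine (h1.comp h2.contMDiffOn (s := e.target) (fun y hy ↦ hy)).congr fun y hy ↦ ?_
  simp [tangentMapWithin, tangentVec, mfderivWithin_of_isOpen e.open_target hy]

theorem contDiffOn_bilinear
    {B : ∀ x : M, TangentSpace (𝓡 n) x →L[ℝ] TangentSpace (𝓡 n) x →L[ℝ] ℝ}
    (hB : ContMDiff (𝓡 n)
      ((𝓡 n).prod 𝓘(ℝ, EuclideanSpace ℝ (Fin n) →L[ℝ] EuclideanSpace ℝ (Fin n) →L[ℝ] ℝ)) ∞
      (fun x ↦ Bundle.TotalSpace.mk'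
        (EuclideanSpace ℝ (Fin n) →L[ℝ] EuclideanSpace ℝ (Fin n) →L[ℝ] ℝ)
        (E := fun x : M ↦ TangentSpace (𝓡 n) x →L[ℝ] TangentSpace (𝓡 n) x →L[ℝ] ℝ) x (B x)))
    (he : e ∈ charts n M) (v w : EuclideanSpace ℝ (Fin n)) :
    ContDiffOn ℝ ∞ (fun y ↦ B (e.symm y) (tangentVec e y v) (tangentVec e y w)) e.target := by
  rw [← contMDiffOn_iff_contDiffOn]
  have hs := contMDiffOn_symm_of_mem_maximalAtlas he
  have h := ContMDiffOn.clm_bundle_apply₂ (F₁ := EuclideanSpace ℝ (Fin n))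
    (F₂ := EuclideanSpace ℝ (Fin n)) (F₃ := ℝ) (E₃ := Bundle.Trivial M ℝ)
    (hB.comp_contMDiffOn hs) (contMDiffOn_tangentVec he v) (contMDiffOn_tangentVec he w)
  intro y hy
  have := h y hy
  rw [Bundle.contMDiffWithinAt_totalSpace] at this
  exact this.2

theorem contDiffOn_oneForm (α : OneForm n M) (he : e ∈ charts n M)
    (v : EuclideanSpace ℝ (Fin n)) :
    ContDiffOn ℝ ∞ (fun y ↦ α.val (e.symm y) (tangentVec e y v)) e.target := by
  rw [← contMDiffOn_iff_contDiffOn]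
  have hs := contMDiffOn_symm_of_mem_maximalAtlas he
  have h := ContMDiffOn.clm_bundle_apply (F₁ := EuclideanSpace ℝ (Fin n))
    (F₂ := ℝ) (E₂ := Bundle.Trivial M ℝ)
    (α.smooth.comp_contMDiffOn hs) (contMDiffOn_tangentVec he v)
  intro y hy
  have := h y hy
  rw [Bundle.contMDiffWithinAt_totalSpace] at this
  exact this.2

variable (g : Metric n M) (F : TwoForm n M)

theorem contDiffOn_metricCoord (he : e ∈ charts n M) (i j : Fin n) :
    ContDiffOn ℝ ∞ (fun y ↦ metricCoord g e y i j) e.target :=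
  contDiffOn_bilinear g.contMDiff he _ _

theorem contDiffOn_formCoord (he : e ∈ charts n M) (i j : Fin n) :
    ContDiffOn ℝ ∞ (formCoord F e i j) e.target :=
  contDiffOn_bilinear F.smooth he _ _

theorem metricCoord_symm (u : EuclideanSpace ℝ (Fin n)) (i j : Fin n) :
    metricCoord g e u i j = metricCoord g e u j i :=
  g.symm _ _ _

/-- Polarization of the alternating condition at `∂ᵢ + ∂ⱼ`. -/
theorem formCoord_antisymm (i j : Fin n) (u : EuclideanSpace ℝ (Fin n)) :
    formCoord F e i j u = - formCoord F e j i u := by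
  have h := F.alternating (e.symm u) (coordVec e i u + coordVec e j u)
  simp only [map_add, _root_.add_apply, F.alternating] at h
  unfold formCoord
  linarith

omit [IsManifold (𝓡 n) ∞ M] in
/-- The chain rule: a map into `M` which is read as `τ` in the coordinates `e` has the derivative
of `τ` as its derivative. -/
theorem mfderiv_eq_tangentVec {m : ℕ} {h : EuclideanSpace ℝ (Fin m) → M}
    {τ : EuclideanSpace ℝ (Fin m) → EuclideanSpace ℝ (Fin n)} {y : EuclideanSpace ℝ (Fin m)}
    (he : e ∈ charts n M) (hτ : DifferentiableAt ℝ τ y) (hy : τ y ∈ e.target)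
    (hh : h =ᶠ[nhds y] fun z ↦ e.symm (τ z)) (v : EuclideanSpace ℝ (Fin m)) :
    (mfderiv (𝓡 m) (𝓡 n) h y v : EuclideanSpace ℝ (Fin n))
      = tangentVec e (τ y) (fderiv ℝ τ y v) := by
  have h1 : mfderiv (𝓡 m) (𝓡 n) h y = mfderiv (𝓡 m) (𝓡 n) (e.symm ∘ τ) y := hh.mfderiv_eq
  rw [h1, mfderiv_comp y (mdifferentiableAt_symm he hy) hτ.mdifferentiableAt, mfderiv_eq_fderiv]
  rfl

omit [IsManifold (𝓡 n) ∞ M] in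
-- The derivative of `e` is a left inverse of the derivative of `e.symm`, by the chain rule for `e ∘
-- e.symm = id` near `u`.
theorem tangentVec_injective (he : e ∈ charts n M) (hu : u ∈ e.target)
    {v : EuclideanSpace ℝ (Fin n)} (hv : tangentVec e u v = 0) : v = 0 := by
  have h2 := contMDiffAt_of_mem_maximalAtlas he (e.map_target hu)
  have h1 : mfderiv (𝓡 n) (𝓡 n) (e ∘ e.symm) u = mfderiv (𝓡 n) (𝓡 n) id u := by
    apply Filter.EventuallyEq.mfderiv_eq
    filter_upwards [e.open_target.mem_nhds hu] with y hy
    exact e.right_inv hy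
  rw [mfderiv_comp u (h2.mdifferentiableAt (by simp)) (mdifferentiableAt_symm he hu),
    mfderiv_id] at h1
  have h3 := congrArg (fun L : EuclideanSpace ℝ (Fin n) →L[ℝ] EuclideanSpace ℝ (Fin n) ↦ L v) h1
  have h4 : v = mfderiv (𝓡 n) (𝓡 n) e (e.symm u) (tangentVec e u v) := h3.symm
  rw [hv, map_zero] at h4
  exact h4

theorem metricCoord_posDef (he : e ∈ charts n M) (hu : u ∈ e.target) :
    (metricCoord g e u).PosDef := by
  refine Matrix.PosDef.of_dotProduct_mulVec_pos ?_ ?_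
  · ext i j
    simpa using metricCoord_symm g u j i
  · intro x hx
    -- The quadratic form of the Gram matrix at `x` is `g(v, v)` for the tangent vector `v` with
    -- components `x`; injectivity of `tangentVec` makes `v` nonzero.
    have key : star x ⬝ᵥ (metricCoord g e u).mulVec x
        = g.inner (e.symm u) (tangentVec e u (WithLp.toLp 2 x))
          (tangentVec e u (WithLp.toLp 2 x)) := by
      have hx2 : (WithLp.toLp 2 x : EuclideanSpace ℝ (Fin n))
          = ∑ i, x i • EuclideanSpace.single i (1 : ℝ) := by
        conv_lhs => rw [← (EuclideanSpace.basisFun (Fin n) ℝ).sum_repr (WithLp.toLp 2 x)]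
        simp
      have hx3 : tangentVec e u (WithLp.toLp 2 x) = ∑ i, x i • coordVec e i u := by
        rw [hx2, tangentVec_sum_smul]
        rfl
      rw [hx3]
      simp only [map_sum, map_smul, _root_.sum_apply, _root_.smul_apply,
        smul_eq_mul, dotProduct, Matrix.mulVec, metricCoord, Matrix.of_apply, Pi.star_apply,
        star_trivial, Finset.mul_sum]
      rw [Finset.sum_comm]
      refine Finset.sum_congr rfl fun i _ ↦ Finset.sum_congr rfl fun j _ ↦ ?_
      ring
    rw [key]
    refine g.pos _ _ fun h0 ↦ hx ?_
    have := tangentVec_injective he hu h0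
    simpa using this

end Smoothness

/-! ### Local potentials of the curvature and `dF = 0` -/

section Curvature

variable {m n : ℕ} {a : Fin m → EuclideanSpace ℝ (Fin m) → ℝ}
  {σ : EuclideanSpace ℝ (Fin n) → EuclideanSpace ℝ (Fin m)}
  {V : Set (EuclideanSpace ℝ (Fin n))} {T : Set (EuclideanSpace ℝ (Fin m))}
  {u : EuclideanSpace ℝ (Fin n)}

theorem fderiv_apply_coord (hσ : DifferentiableAt ℝ σ u) (v : EuclideanSpace ℝ (Fin n))
    (c : Fin m) : fderiv ℝ (fun y ↦ σ y c) u v = fderiv ℝ σ u v c := by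
  have h := (EuclideanSpace.proj (𝕜 := ℝ) c).hasFDerivAt.comp u hσ.hasFDerivAt
  have h2 : HasFDerivAt (fun y ↦ σ y c)
    ((EuclideanSpace.proj (𝕜 := ℝ) c).comp (fderiv ℝ σ u)) u := h
  rw [h2.fderiv]
  rfl

theorem contDiffOn_apply_coord (hσ : ContDiffOn ℝ ∞ σ V) (c : Fin m) :
    ContDiffOn ℝ ∞ (fun y ↦ σ y c) V :=
  (EuclideanSpace.proj (𝕜 := ℝ) c).contDiff.comp_contDiffOn hσ

/-- The components `bⱼ = ∑ aᶜ(σ) ∂ⱼ σᶜ` of the pull-back of the 1-form `∑ aᶜ dxᶜ` along `σ`. -/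
noncomputable def pullbackCoord (a : Fin m → EuclideanSpace ℝ (Fin m) → ℝ)
    (σ : EuclideanSpace ℝ (Fin n) → EuclideanSpace ℝ (Fin m)) (j : Fin n)
    (y : EuclideanSpace ℝ (Fin n)) : ℝ :=
  ∑ c, a c (σ y) * partialDeriv j (fun z ↦ σ z c) y

theorem contDiffOn_pullbackCoord (hV : IsOpen V) (hσ : ContDiffOn ℝ ∞ σ V)
    (hVT : Set.MapsTo σ V T) (ha : ∀ c, ContDiffOn ℝ ∞ (a c) T) (j : Fin n) :
    ContDiffOn ℝ ∞ (pullbackCoord a σ j) V :=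
  ContDiffOn.sum fun c _ ↦ ((ha c).comp hσ hVT).mul
    (contDiffOn_partialDeriv hV (contDiffOn_apply_coord hσ c) j)

/-- Exterior differentiation commutes with pull-backs. -/
theorem partialDeriv_pullbackCoord_sub (hV : IsOpen V) (hT : IsOpen T) (hσ : ContDiffOn ℝ ∞ σ V)
    (hVT : Set.MapsTo σ V T) (ha : ∀ c, ContDiffOn ℝ ∞ (a c) T) (hu : u ∈ V) (i j : Fin n) :
    partialDeriv i (pullbackCoord a σ j) u - partialDeriv j (pullbackCoord a σ i) u
      = ∑ c, (fderiv ℝ σ u (EuclideanSpace.single j 1) c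
            * fderiv ℝ (a c) (σ u) (fderiv ℝ σ u (EuclideanSpace.single i 1))
          - fderiv ℝ σ u (EuclideanSpace.single i 1) c
            * fderiv ℝ (a c) (σ u) (fderiv ℝ σ u (EuclideanSpace.single j 1))) := by
  have hσu : DifferentiableAt ℝ σ u := (hσ.contDiffAt (hV.mem_nhds hu)).differentiableAt (by simp)
  have key : ∀ i j : Fin n, partialDeriv i (pullbackCoord a σ j) u
      = ∑ c, (fderiv ℝ (a c) (σ u) (fderiv ℝ σ u (EuclideanSpace.single i 1))
            * fderiv ℝ σ u (EuclideanSpace.single j 1) c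
          + a c (σ u) * partialDeriv i (partialDeriv j (fun z ↦ σ z c)) u) := by
    intro i j
    have hac : ∀ c, ContDiffOn ℝ ∞ (fun y ↦ a c (σ y)) V := fun c ↦ (ha c).comp hσ hVT
    have hd := fun c ↦ contDiffOn_partialDeriv hV (contDiffOn_apply_coord hσ c) j
    unfold pullbackCoord
    rw [partialDeriv_sum _ _ fun c _ ↦ differentiableAt_of_contDiffOn hV ((hac c).mul (hd c)) hu]
    refine Finset.sum_congr rfl fun c _ ↦ ?_
    rw [partialDeriv_mul i (differentiableAt_of_contDiffOn hV (hac c) hu)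
      (differentiableAt_of_contDiffOn hV (hd c) hu)]
    congr 2
    · unfold partialDeriv
      rw [fderiv_fun_comp u (differentiableAt_of_contDiffOn hT (ha c) (hVT hu)) hσu]
      rfl
    · exact fderiv_apply_coord hσu _ c
  rw [key, key, ← Finset.sum_sub_distrib]
  refine Finset.sum_congr rfl fun c _ ↦ ?_
  -- The second derivatives of `σ` cancel by symmetry; only derivatives of the coefficients survive.
  rw [partialDeriv_comm hV (contDiffOn_apply_coord hσ c) hu i j]
  ring

variable {M : Type*} [TopologicalSpace M] [ChartedSpace (EuclideanSpace ℝ (Fin n)) M]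
  [IsManifold (𝓡 n) ∞ M]

theorem oneForm_tangentVec (α : OneForm n M)
    (e : OpenPartialHomeomorph M (EuclideanSpace ℝ (Fin n))) (y w : EuclideanSpace ℝ (Fin n)) :
    α.val (e.symm y) (tangentVec e y w) = ∑ c, w c * α.val (e.symm y) (coordVec e c y) := by
  have hw : w = ∑ i, w i • EuclideanSpace.single i (1 : ℝ) := by
    conv_lhs => rw [← (EuclideanSpace.basisFun (Fin n) ℝ).sum_repr w]
    simp
  conv_lhs => rw [hw, tangentVec_sum_smul, map_sum]
  simp only [map_smul, smul_eq_mul, coordVec]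

/-- Expanding in components brings the exterior derivative to the shape of the right side of
`partialDeriv_pullbackCoord_sub`. -/
theorem extDerivOneForm_eq_sum (α : OneForm n M)
    {e : OpenPartialHomeomorph M (EuclideanSpace ℝ (Fin n))} (he : e ∈ charts n M)
    (hu : u ∈ e.target) (v w : EuclideanSpace ℝ (Fin n)) :
    extDerivOneForm α e u v w
      = ∑ c, (w c * fderiv ℝ (fun y ↦ α.val (e.symm y) (coordVec e c y)) u v
          - v c * fderiv ℝ (fun y ↦ α.val (e.symm y) (coordVec e c y)) u w) := by
  have hd : ∀ c, DifferentiableAt ℝ (fun y ↦ α.val (e.symm y) (coordVec e c y)) u := fun c ↦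
    differentiableAt_of_contDiffOn e.open_target (contDiffOn_oneForm α he _) hu
  have key : ∀ v w : EuclideanSpace ℝ (Fin n),
      fderiv ℝ (fun y ↦ α.val (e.symm y) (tangentVec e y w)) u v
        = ∑ c, w c * fderiv ℝ (fun y ↦ α.val (e.symm y) (coordVec e c y)) u v := by
    intro v w
    simp_rw [oneForm_tangentVec α e _ w]
    rw [fderiv_fun_sum fun c _ ↦ (hd c).const_mul (w c), _root_.sum_apply]
    refine Finset.sum_congr rfl fun c _ ↦ ?_
    rw [fderiv_const_mul (hd c)]
    rfl
  rw [extDerivOneForm, key, key, Finset.sum_sub_distrib]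

variable {P : Type*} [TopologicalSpace P] [ChartedSpace (EuclideanSpace ℝ (Fin (n + 1))) P]
  [IsManifold (𝓡 (n + 1)) ∞ P] [MulAction Circle P]
  {proj : P → M} {A : OneForm (n + 1) P} {F : TwoForm n M}
  {e : OpenPartialHomeomorph M (EuclideanSpace ℝ (Fin n))}

omit [IsManifold (𝓡 n) ∞ M] [IsManifold (𝓡 (n + 1)) ∞ P] in
/-- A principal bundle with projection `proj` has local sections, and `proj` is differentiable along
them. -/
theorem IsPrincipalCircleBundle.exists_section
    (hb : IsPrincipalCircleBundle (n := n) proj) (x : M) :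
    ∃ (U : Set M) (s : M → P), IsOpen U ∧ x ∈ U ∧ ContMDiffOn (𝓡 n) (𝓡 (n + 1)) ∞ s U ∧
      (∀ y ∈ U, proj (s y) = y) ∧
      ∀ y ∈ U, MDifferentiableAt (𝓡 (n + 1)) (𝓡 n) proj (s y) := by
  obtain ⟨U, φ, hU, hx, hsrc, htgt, hφ, hφs, hproj, -⟩ := hb.locally_trivial x
  have hmem : ∀ y ∈ U, φ.symm (y, 1) ∈ φ.source := fun y hy ↦
    φ.map_target (by rw [htgt]; exact ⟨hy, trivial⟩)
  -- The section is the unit section of the trivialization. Near it `proj` is the first component of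
  -- `φ`, hence differentiable.
  refine ⟨U, fun y ↦ φ.symm (y, 1), hU, hx, ?_, fun y hy ↦ ?_, fun y hy ↦ ?_⟩
  · refine hφs.comp (contMDiff_id.prodMk contMDiff_const).contMDiffOn fun y hy ↦ ?_
    rw [Set.mem_preimage, htgt]
    exact ⟨hy, trivial⟩
  · rw [← hproj _ (hmem y hy), φ.right_inv (by rw [htgt]; exact ⟨hy, trivial⟩)]
  · have h1 : MDifferentiableAt (𝓡 (n + 1)) (𝓡 n) (fun p ↦ (φ p).1) (φ.symm (y, 1)) :=
      ((hφ.contMDiffAt (φ.open_source.mem_nhds (hmem y hy))).fst).mdifferentiableAt (by simp)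
    refine h1.congr_of_eventuallyEq ?_
    filter_upwards [φ.open_source.mem_nhds (hmem y hy)] with p hp
    exact (hproj p hp).symm

/-- The curvature of a connection has local potentials. -/
theorem IsCurvature.exists_potential (hb : IsPrincipalCircleBundle (n := n) proj)
    (hc : IsCurvature proj A F) (he : e ∈ charts n M) (hu : u ∈ e.target) :
    ∃ (V : Set (EuclideanSpace ℝ (Fin n))) (b : Fin n → EuclideanSpace ℝ (Fin n) → ℝ),
      IsOpen V ∧ u ∈ V ∧ (∀ j, ContDiffOn ℝ ∞ (b j) V) ∧
      ∀ y ∈ V, ∀ i j, formCoord F e i j y = partialDeriv i (b j) y - partialDeriv j (b i) y := by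
  obtain ⟨U, s, hU, hxU, hs, hps, hpd⟩ := hb.exists_section (e.symm u)
  set S : EuclideanSpace ℝ (Fin n) → P := fun y ↦ s (e.symm y) with hS
  have hW : IsOpen (e.target ∩ e.symm ⁻¹' U) := e.symm.isOpen_inter_preimage hU
  have hSm : ContMDiffOn (𝓡 n) (𝓡 (n + 1)) ∞ S (e.target ∩ e.symm ⁻¹' U) :=
    hs.comp ((contMDiffOn_symm_of_mem_maximalAtlas he).mono Set.inter_subset_left)
      fun y hy ↦ hy.2
  set e' := chartAt (EuclideanSpace ℝ (Fin (n + 1))) (S u)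
  have he' : e' ∈ charts (n + 1) P := IsManifold.chart_mem_maximalAtlas (S u)
  set V := (e.target ∩ e.symm ⁻¹' U) ∩ S ⁻¹' e'.source
  have hV : IsOpen V := hSm.continuousOn.isOpen_inter_preimage hW e'.open_source
  have hSV : ContMDiffOn (𝓡 n) (𝓡 (n + 1)) ∞ S V := hSm.mono Set.inter_subset_left
  set σ : EuclideanSpace ℝ (Fin n) → EuclideanSpace ℝ (Fin (n + 1)) := fun y ↦ e' (S y)
  have hσ : ContDiffOn ℝ ∞ σ V := by
    rw [← contMDiffOn_iff_contDiffOn]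
    exact (contMDiffOn_of_mem_maximalAtlas he').comp hSV fun y hy ↦ hy.2
  have hσT : Set.MapsTo σ V e'.target := fun y hy ↦ e'.map_source hy.2
  have hσS : ∀ y ∈ V, e'.symm (σ y) = S y := fun y hy ↦ e'.left_inv hy.2
  let a : Fin (n + 1) → EuclideanSpace ℝ (Fin (n + 1)) → ℝ :=
    fun c z ↦ A.val (e'.symm z) (coordVec e' c z)
  have ha : ∀ c, ContDiffOn ℝ ∞ (a c) e'.target := fun c ↦ contDiffOn_oneForm A he' _
  -- The potential is `s*A`, and `d(s*A) = s*(dA) = s*(proj*F) = F` because `proj ∘ s = id`.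
  refine ⟨V, pullbackCoord a σ, hV, ⟨⟨hu, hxU⟩, mem_chart_source _ _⟩,
    contDiffOn_pullbackCoord hV hσ hσT ha, fun y hy i j ↦ ?_⟩
  rw [partialDeriv_pullbackCoord_sub hV e'.open_target hσ hσT ha hy,
    ← extDerivOneForm_eq_sum A he' (hσT hy), ← hc e' he' (σ y) (hσT hy)]
  have hσy : DifferentiableAt ℝ σ y := (hσ.contDiffAt (hV.mem_nhds hy)).differentiableAt (by simp)
  have hVn : V ∈ nhds y := hV.mem_nhds hy
  -- This is the derivative of `proj ∘ S = e.symm`, with the derivative of `S` read in the chart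
  -- `e'` of `P`.
  have hvec : ∀ v : EuclideanSpace ℝ (Fin n),
      (mfderiv (𝓡 (n + 1)) (𝓡 n) proj (e'.symm (σ y)) (tangentVec e' (σ y) (fderiv ℝ σ y v)) :
        EuclideanSpace ℝ (Fin n)) = tangentVec e y v := by
    intro v
    have h1 : (mfderiv (𝓡 n) (𝓡 (n + 1)) S y v : EuclideanSpace ℝ (Fin (n + 1)))
        = tangentVec e' (σ y) (fderiv ℝ σ y v) :=
      mfderiv_eq_tangentVec he' hσy (hσT hy)
        (by filter_upwards [hVn] with z hz using (hσS z hz).symm) v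
    have h2 : mfderiv (𝓡 n) (𝓡 n) (proj ∘ S) y = mfderiv (𝓡 n) (𝓡 n) e.symm y := by
      apply Filter.EventuallyEq.mfderiv_eq
      filter_upwards [hVn] with z hz using hps _ hz.1.2
    rw [mfderiv_comp y (hpd _ hy.1.2) ((hSV.contMDiffAt hVn).mdifferentiableAt (by simp))] at h2
    have h3 := congrArg (fun L : EuclideanSpace ℝ (Fin n) →L[ℝ] EuclideanSpace ℝ (Fin n) ↦ L v) h2
    -- The tangent spaces at equal points are distinct types, so equality of base points is used by
    -- substitution, here and in `hbase`.
    have h4 : ∀ p q : P, p = q → ∀ w : EuclideanSpace ℝ (Fin (n + 1)),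
        (mfderiv (𝓡 (n + 1)) (𝓡 n) proj p w : EuclideanSpace ℝ (Fin n))
          = mfderiv (𝓡 (n + 1)) (𝓡 n) proj q w := by
      rintro p q rfl w; rfl
    refine (h4 _ _ (hσS y hy) _).trans (Eq.trans ?_ h3)
    rw [← h1]
    rfl
  have hbase : ∀ x x' : M, x = x' → ∀ v w v' w' : EuclideanSpace ℝ (Fin n), v = v' → w = w' →
      F.val x v w = F.val x' v' w' := by
    rintro x x' rfl v w v' w' rfl rfl; rfl
  refine hbase _ _ ?_ _ _ _ _ (hvec _).symm (hvec _).symm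
  rw [hσS y hy]
  exact (hps _ hy.1.2).symm

/-- The Bianchi identity `dF = 0`. -/
theorem partialDeriv_formCoord_cyclic (hb : IsPrincipalCircleBundle (n := n) proj)
    (hc : IsCurvature proj A F) (he : e ∈ charts n M) (hu : u ∈ e.target) (i j k : Fin n) :
    partialDeriv i (formCoord F e j k) u + partialDeriv j (formCoord F e k i) u
      + partialDeriv k (formCoord F e i j) u = 0 := by
  obtain ⟨V, b, hV, huV, hbV, hF⟩ := hc.exists_potential hb he hu
  -- In the cyclic sum, the second derivatives of the potential cancel in pairs.
  have key : ∀ i j k : Fin n, partialDeriv i (formCoord F e j k) u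
      = partialDeriv i (partialDeriv j (b k)) u - partialDeriv i (partialDeriv k (b j)) u := by
    intro i j k
    rw [partialDeriv_congr_of_eqOn hV huV i fun y hy ↦ hF y hy j k]
    exact partialDeriv_sub i
      (differentiableAt_of_contDiffOn hV (contDiffOn_partialDeriv hV (hbV k) j) huV)
      (differentiableAt_of_contDiffOn hV (contDiffOn_partialDeriv hV (hbV j) k) huV)
  rw [key, key, key, partialDeriv_comm hV (hbV k) huV i j, partialDeriv_comm hV (hbV j) huV i k,
    partialDeriv_comm hV (hbV i) huV j k]
  ring

end Curvature

/-! ### Change of coordinates and invariance of `|F|²` -/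

section ChartChange

variable {n : ℕ}

/-- The Jacobian matrix of a change of coordinates. -/
noncomputable def jacobian (τ : EuclideanSpace ℝ (Fin n) → EuclideanSpace ℝ (Fin n))
    (y : EuclideanSpace ℝ (Fin n)) : Matrix (Fin n) (Fin n) ℝ :=
  Matrix.of fun a i ↦ partialDeriv i (fun z ↦ τ z a) y

variable {M : Type*} [TopologicalSpace M] [ChartedSpace (EuclideanSpace ℝ (Fin n)) M]
  [IsManifold (𝓡 n) ∞ M] {e e' : OpenPartialHomeomorph M (EuclideanSpace ℝ (Fin n))}
  {τ : EuclideanSpace ℝ (Fin n) → EuclideanSpace ℝ (Fin n)} {y : EuclideanSpace ℝ (Fin n)}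

omit [IsManifold (𝓡 n) ∞ M] in
theorem coordVec_eq_sum (he : e ∈ charts n M) (hτ : DifferentiableAt ℝ τ y)
    (hy : τ y ∈ e.target) (hh : e'.symm =ᶠ[nhds y] fun z ↦ e.symm (τ z)) (i : Fin n) :
    (coordVec e' i y : EuclideanSpace ℝ (Fin n)) = ∑ a, jacobian τ y a i • coordVec e a (τ y) := by
  refine (mfderiv_eq_tangentVec he hτ hy hh (EuclideanSpace.single i 1)).trans ?_
  have hw : fderiv ℝ τ y (EuclideanSpace.single i 1)
      = ∑ a, jacobian τ y a i • EuclideanSpace.single a (1 : ℝ) := by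
    conv_lhs => rw [← (EuclideanSpace.basisFun (Fin n) ℝ).sum_repr (fderiv ℝ τ y _)]
    refine Finset.sum_congr rfl fun a _ ↦ ?_
    simp only [EuclideanSpace.basisFun_repr, EuclideanSpace.basisFun_apply]
    rw [← fderiv_apply_coord hτ]
    rfl
  rw [hw, tangentVec_sum_smul]
  rfl

omit [IsManifold (𝓡 n) ∞ M] in
-- One congruence law serves both the metric and `F`; neither symmetry nor smoothness of `B` enters.
theorem bilinear_coordVec_eq
    (B : ∀ x : M, TangentSpace (𝓡 n) x →L[ℝ] TangentSpace (𝓡 n) x →L[ℝ] ℝ)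
    (he : e ∈ charts n M) (hτ : DifferentiableAt ℝ τ y)
    (hy : τ y ∈ e.target) (hh : e'.symm =ᶠ[nhds y] fun z ↦ e.symm (τ z)) :
    (Matrix.of fun i j ↦ B (e'.symm y) (coordVec e' i y) (coordVec e' j y))
      = (jacobian τ y).transpose
        * (Matrix.of fun i j ↦ B (e.symm (τ y)) (coordVec e i (τ y)) (coordVec e j (τ y)))
        * jacobian τ y := by
  have hbase : ∀ x x' : M, x = x' → ∀ v w v' w' : EuclideanSpace ℝ (Fin n), v = v' → w = w' →
      B x v w = B x' v' w' := by
    rintro x x' rfl v w v' w' rfl rfl; rfl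
  ext i j
  rw [Matrix.of_apply]
  refine (hbase _ _ hh.eq_of_nhds _ _ _ _ (coordVec_eq_sum he hτ hy hh i)
    (coordVec_eq_sum he hτ hy hh j)).trans ?_
  have h : ∀ b : TangentSpace (𝓡 n) (e.symm (τ y)) →L[ℝ]
        TangentSpace (𝓡 n) (e.symm (τ y)) →L[ℝ] ℝ,
      ∀ v : Fin n → TangentSpace (𝓡 n) (e.symm (τ y)),
      b (∑ a, jacobian τ y a i • v a) (∑ a, jacobian τ y a j • v a)
        = ∑ c, (∑ d, jacobian τ y d i * b (v d) (v c)) * jacobian τ y c j := by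
    intro b v
    simp only [map_sum, map_smul, _root_.sum_apply, _root_.smul_apply, smul_eq_mul,
      Finset.sum_mul, Finset.mul_sum]
    refine Finset.sum_congr rfl fun c _ ↦ Finset.sum_congr rfl fun d _ ↦ ?_
    ring
  simp only [Matrix.mul_apply, Matrix.transpose_apply, Matrix.of_apply]
  exact h _ _

variable (g : Metric n M) (F : TwoForm n M)

theorem metricCoord_change (he : e ∈ charts n M) (hτ : DifferentiableAt ℝ τ y)
    (hy : τ y ∈ e.target) (hh : e'.symm =ᶠ[nhds y] fun z ↦ e.symm (τ z)) :
    metricCoord g e' y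
      = (jacobian τ y).transpose * metricCoord g e (τ y) * jacobian τ y :=
  bilinear_coordVec_eq g.inner he hτ hy hh

theorem formCoord_change (he : e ∈ charts n M) (hτ : DifferentiableAt ℝ τ y)
    (hy : τ y ∈ e.target) (hh : e'.symm =ᶠ[nhds y] fun z ↦ e.symm (τ z)) :
    (Matrix.of fun i j ↦ formCoord F e' i j y)
      = (jacobian τ y).transpose * (Matrix.of fun i j ↦ formCoord F e i j (τ y))
        * jacobian τ y :=
  bilinear_coordVec_eq F.val he hτ hy hh

theorem formNormSq_eq_trace (x : M) :
    formNormSq g F e x = ((metricCoord g e (e x))⁻¹ * (Matrix.of fun i j ↦ formCoord F e i j (e x))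
      * (metricCoord g e (e x))⁻¹.transpose
      * (Matrix.of fun i j ↦ formCoord F e i j (e x)).transpose).trace := by
  simp only [formNormSq, invMetricCoord, Matrix.trace, Matrix.diag, Matrix.mul_apply,
    Matrix.transpose_apply, Matrix.of_apply, Finset.sum_mul]
  refine Finset.sum_congr rfl fun i _ ↦ ?_
  rw [Finset.sum_comm]
  refine Finset.sum_congr rfl fun k _ ↦ ?_
  rw [Finset.sum_comm]
  refine Finset.sum_congr rfl fun l _ ↦ Finset.sum_congr rfl fun j _ ↦ ?_
  ring

/-- The inner factors of `J` cancel, leaving a matrix conjugated by `J`, and the trace is cyclic. -/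
theorem trace_congruence (J G K : Matrix (Fin n) (Fin n) ℝ) (hJ : IsUnit J.det) :
    ((J.transpose * G * J)⁻¹ * (J.transpose * K * J) * (J.transpose * G * J)⁻¹.transpose
      * (J.transpose * K * J).transpose).trace
      = (G⁻¹ * K * G⁻¹.transpose * K.transpose).trace := by
  have h1 : J * J⁻¹ = 1 := Matrix.mul_nonsing_inv J hJ
  have h2 : (J⁻¹).transpose * J.transpose = 1 := by
    rw [← Matrix.transpose_mul, h1, Matrix.transpose_one]
  have h3 : (J.transpose)⁻¹ = (J⁻¹).transpose := (Matrix.transpose_nonsing_inv J).symm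
  have h : (J.transpose * G * J)⁻¹ * (J.transpose * K * J) * (J.transpose * G * J)⁻¹.transpose
      * (J.transpose * K * J).transpose
      = J⁻¹ * (G⁻¹ * K * G⁻¹.transpose * K.transpose * J) := by
    simp only [Matrix.mul_inv_rev, h3, Matrix.transpose_mul, Matrix.transpose_transpose]
    calc _ = J⁻¹ * G⁻¹ * ((J⁻¹).transpose * J.transpose) * K * (J * J⁻¹) * G⁻¹.transpose
          * ((J⁻¹).transpose * J.transpose) * K.transpose * J := by simp only [Matrix.mul_assoc]
      _ = _ := by simp only [h1, h2, Matrix.mul_one, Matrix.mul_assoc]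
  rw [h, Matrix.trace_mul_comm, Matrix.mul_assoc, h1, Matrix.mul_one]

/-- The function `|F|²` does not depend on the coordinates. -/
theorem formNormSq_eq (he : e ∈ charts n M) (he' : e' ∈ charts n M) {x : M} (hx : x ∈ e.source)
    (hx' : x ∈ e'.source) : formNormSq g F e' x = formNormSq g F e x := by
  set τ : EuclideanSpace ℝ (Fin n) → EuclideanSpace ℝ (Fin n) := fun z ↦ e (e'.symm z)
  have hxe : e'.symm (e' x) = x := e'.left_inv hx'
  have hmem : e'.symm (e' x) ∈ e.source := by rwa [hxe]
  have hτ : DifferentiableAt ℝ τ (e' x) := by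
    rw [← mdifferentiableAt_iff_differentiableAt]
    exact ((contMDiffAt_of_mem_maximalAtlas he hmem).mdifferentiableAt (by simp)).comp _
      (mdifferentiableAt_symm he' (e'.map_source hx'))
  have hτx : τ (e' x) = e x := congrArg e hxe
  have hy : τ (e' x) ∈ e.target := e.map_source hmem
  have hh : e'.symm =ᶠ[nhds (e' x)] fun z ↦ e.symm (τ z) := by
    filter_upwards [(e'.symm.isOpen_inter_preimage e.open_source).mem_nhds
      ⟨e'.map_source hx', hmem⟩] with z hz
    exact (e.left_inv hz.2).symm
  have hg := metricCoord_change g he hτ hy hh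
  have hF := formCoord_change F he hτ hy hh
  rw [hτx] at hg hF
  -- Both Gram matrices are related by `J`, and the one for `e'` has nonzero determinant; so `det J
  -- ≠ 0`.
  have hJ : IsUnit (jacobian τ (e' x)).det := by
    have h := (metricCoord_posDef g he' (e'.map_source hx')).det_pos.ne'
    rw [hg, Matrix.det_mul] at h
    exact (right_ne_zero_of_mul h).isUnit
  rw [formNormSq_eq_trace, formNormSq_eq_trace, hg, hF, trace_congruence _ _ _ hJ]

end ChartChange

/-! ### Coordinates normal to first order at a point -/

section NormalCoordinates

variable {n : ℕ} {ψ : EuclideanSpace ℝ (Fin n) → EuclideanSpace ℝ (Fin n)}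

theorem fderiv_apply_eq_jacobian_mulVec {y : EuclideanSpace ℝ (Fin n)}
    (hψ : DifferentiableAt ℝ ψ y) (v : EuclideanSpace ℝ (Fin n)) (a : Fin n) :
    fderiv ℝ ψ y v a = (jacobian ψ y).mulVec v a := by
  rw [← fderiv_apply_coord hψ, fderiv_eq_sum_partialDeriv]
  simp only [Matrix.mulVec, dotProduct, jacobian, Matrix.of_apply]
  exact Finset.sum_congr rfl fun i _ ↦ mul_comm _ _

theorem exists_hasFDerivAt_equiv {y : EuclideanSpace ℝ (Fin n)} (hψ : DifferentiableAt ℝ ψ y)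
    (hJ : (jacobian ψ y).det ≠ 0) :
    ∃ L : EuclideanSpace ℝ (Fin n) ≃L[ℝ] EuclideanSpace ℝ (Fin n),
      HasFDerivAt ψ (L : EuclideanSpace ℝ (Fin n) →L[ℝ] EuclideanSpace ℝ (Fin n)) y := by
  have hinj : Function.Injective (fderiv ℝ ψ y) := by
    rw [injective_iff_map_eq_zero]
    intro v hv
    have h0 : (jacobian ψ y).mulVec v = 0 := by
      ext a
      rw [← fderiv_apply_eq_jacobian_mulVec hψ, hv]
      rfl
    ext a
    exact congrFun (Matrix.eq_zero_of_mulVec_eq_zero hJ h0) a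
  refine ⟨(LinearEquiv.ofInjectiveEndo
    (fderiv ℝ ψ y : EuclideanSpace ℝ (Fin n) →ₗ[ℝ] EuclideanSpace ℝ (Fin n))
    hinj).toContinuousLinearEquiv, ?_⟩
  convert hψ.hasFDerivAt using 1
  ext v
  rfl

theorem continuous_jacobian_det (hψ : ContDiff ℝ ∞ ψ) :
    Continuous fun y ↦ (jacobian ψ y).det := by
  refine Continuous.matrix_det (continuous_matrix fun a i ↦ ?_)
  have h := contDiffOn_partialDeriv isOpen_univ (contDiffOn_apply_coord hψ.contDiffOn a) i
  exact continuousOn_univ.1 h.continuousOn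

variable {M : Type*} [TopologicalSpace M] [ChartedSpace (EuclideanSpace ℝ (Fin n)) M]
  [IsManifold (𝓡 n) ∞ M] {e : OpenPartialHomeomorph M (EuclideanSpace ℝ (Fin n))}

/-- New coordinates `e'` are obtained from the coordinates `e` by a smooth substitution `ψ`. -/
theorem exists_chart_substitution (he : e ∈ charts n M) (hψ : ContDiff ℝ ∞ ψ)
    (h0 : ψ 0 ∈ e.target) (hJ : (jacobian ψ 0).det ≠ 0) :
    ∃ e' ∈ charts n M, (0 : EuclideanSpace ℝ (Fin n)) ∈ e'.target ∧
      ∀ y ∈ e'.target, ψ y ∈ e.target ∧ e'.symm =ᶠ[nhds y] fun z ↦ e.symm (ψ z) := by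
  have hd : ∀ y, DifferentiableAt ℝ ψ y := fun y ↦ (hψ.differentiable (by simp)) y
  obtain ⟨L, hL⟩ := exists_hasFDerivAt_equiv (hd 0) hJ
  set D : Set (EuclideanSpace ℝ (Fin n)) := {y | (jacobian ψ y).det ≠ 0}
  have hD : IsOpen D := isOpen_ne_fun (continuous_jacobian_det hψ) continuous_const
  -- The local inverse is restricted to where the Jacobian is invertible, so that it is smooth on
  -- the whole target and not only at `ψ 0`.
  set Ψ := (hψ.contDiffAt.toOpenPartialHomeomorph ψ hL (by simp)).restrOpen D hD
  have hΨ : ⇑Ψ = ψ := rfl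
  have hΨ0 : (0 : EuclideanSpace ℝ (Fin n)) ∈ Ψ.source :=
    ⟨hψ.contDiffAt.mem_toOpenPartialHomeomorph_source hL (by simp), hJ⟩
  have hΨs : ContDiffOn ℝ ∞ Ψ.symm Ψ.target := by
    intro z hz
    have hz' : Ψ.symm z ∈ D := (Ψ.map_target hz).2
    obtain ⟨L', hL'⟩ := exists_hasFDerivAt_equiv (hd _) hz'
    exact (Ψ.contDiffAt_symm hz (hΨ ▸ hL') (hΨ ▸ hψ.contDiffAt)).contDiffWithinAt
  have hsymm : ∀ z, (e.trans Ψ.symm).symm z = e.symm (ψ z) := fun z ↦ rfl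
  have htgt : (e.trans Ψ.symm).target = Ψ.source ∩ ψ ⁻¹' e.target := by
    rw [OpenPartialHomeomorph.trans_target]
    rfl
  refine ⟨e.trans Ψ.symm, ?_, ?_, fun y hy ↦ ?_⟩
  · rw [charts, IsManifold.mem_maximalAtlas_iff_contMDiffOn]
    constructor
    · rw [OpenPartialHomeomorph.trans_source]
      exact (contMDiffOn_iff_contDiffOn.2 hΨs).comp
        ((contMDiffOn_of_mem_maximalAtlas he).mono Set.inter_subset_left) fun x hx ↦ hx.2
    · rw [htgt]
      exact (contMDiffOn_symm_of_mem_maximalAtlas he).comp hψ.contMDiff.contMDiffOn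
        fun x hx ↦ hx.2
  · rw [htgt]
    exact ⟨hΨ0, h0⟩
  · rw [htgt] at hy
    exact ⟨hy.2, Filter.Eventually.of_forall hsymm⟩

/-- The polynomial map of degree two with the given coefficients. -/
noncomputable def quadraticMap (u : EuclideanSpace ℝ (Fin n)) (B : Matrix (Fin n) (Fin n) ℝ)
    (p : Fin n → Fin n → Fin n → ℝ) (y : EuclideanSpace ℝ (Fin n)) : EuclideanSpace ℝ (Fin n) :=
  WithLp.toLp 2 fun a ↦ u a + ∑ i, B a i * y i + (1 / 2) * ∑ b, ∑ c, p a b c * (y b * y c)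

theorem contDiff_coord (i : Fin n) : ContDiff ℝ ∞ fun y : EuclideanSpace ℝ (Fin n) ↦ y i :=
  (EuclideanSpace.proj (𝕜 := ℝ) i).contDiff

theorem partialDeriv_coord (i j : Fin n) (y : EuclideanSpace ℝ (Fin n)) :
    partialDeriv i (fun z ↦ z j) y = if i = j then 1 else 0 := by
  have h : HasFDerivAt (fun z : EuclideanSpace ℝ (Fin n) ↦ z j)
    (EuclideanSpace.proj (𝕜 := ℝ) j) y := (EuclideanSpace.proj (𝕜 := ℝ) j).hasFDerivAt
  rw [partialDeriv, h.fderiv]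
  simp [eq_comm]

variable (u : EuclideanSpace ℝ (Fin n)) (B : Matrix (Fin n) (Fin n) ℝ)
  (p : Fin n → Fin n → Fin n → ℝ)

theorem contDiff_quadraticMap : ContDiff ℝ ∞ (quadraticMap u B p) := by
  rw [contDiff_euclidean]
  intro a
  have h := contDiff_coord (n := n)
  change ContDiff ℝ ∞ fun y : EuclideanSpace ℝ (Fin n) ↦
    u a + ∑ i, B a i * y i + (1 / 2) * ∑ b, ∑ c, p a b c * (y b * y c)
  exact (contDiff_const.add (ContDiff.sum fun i _ ↦ contDiff_const.mul (h i))).add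
    (contDiff_const.mul (ContDiff.sum fun b _ ↦ ContDiff.sum fun c _ ↦
      contDiff_const.mul ((h b).mul (h c))))

theorem quadraticMap_zero : quadraticMap u B p 0 = u := by
  ext a
  simp [quadraticMap]

/-- Symmetry of `p` makes the two Leibniz terms equal, which cancels the factor `1 / 2`. -/
theorem jacobian_quadraticMap (hp : ∀ a b c, p a b c = p a c b) (y : EuclideanSpace ℝ (Fin n))
    (a i : Fin n) : jacobian (quadraticMap u B p) y a i = B a i + ∑ c, p a i c * y c := by
  have hd : ∀ i : Fin n, DifferentiableAt ℝ (fun z : EuclideanSpace ℝ (Fin n) ↦ z i) y :=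
    fun i ↦ (contDiff_coord i).contDiffAt.differentiableAt (by simp)
  have hq : ∀ b c, DifferentiableAt ℝ
      (fun z : EuclideanSpace ℝ (Fin n) ↦ p a b c * (z b * z c)) y :=
    fun b c ↦ ((hd b).mul (hd c)).const_mul _
  have hl : ∀ j, DifferentiableAt ℝ (fun z : EuclideanSpace ℝ (Fin n) ↦ B a j * z j) y :=
    fun j ↦ (hd j).const_mul _
  have hq1 : ∀ b, DifferentiableAt ℝ
      (fun z : EuclideanSpace ℝ (Fin n) ↦ ∑ c, p a b c * (z b * z c)) y :=
    fun b ↦ DifferentiableAt.fun_sum fun c _ ↦ hq b c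
  have hq2 : DifferentiableAt ℝ
      (fun z : EuclideanSpace ℝ (Fin n) ↦ ∑ b, ∑ c, p a b c * (z b * z c)) y :=
    DifferentiableAt.fun_sum fun b _ ↦ hq1 b
  have hl1 : DifferentiableAt ℝ (fun z : EuclideanSpace ℝ (Fin n) ↦ ∑ j, B a j * z j) y :=
    DifferentiableAt.fun_sum fun j _ ↦ hl j
  change partialDeriv i (fun z : EuclideanSpace ℝ (Fin n) ↦
    u a + ∑ j, B a j * z j + (1 / 2) * ∑ b, ∑ c, p a b c * (z b * z c)) y = _
  rw [partialDeriv_add i ((differentiableAt_const _).fun_add hl1) (hq2.const_mul _),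
    partialDeriv_add i (differentiableAt_const _) hl1, partialDeriv_const,
    partialDeriv_const_mul i _ hq2, partialDeriv_sum _ i fun j _ ↦ hl j,
    partialDeriv_sum _ i fun b _ ↦ hq1 b]
  have h1 : ∀ j, partialDeriv i (fun z : EuclideanSpace ℝ (Fin n) ↦ B a j * z j) y
      = if i = j then B a j else 0 := fun j ↦ by
    rw [partialDeriv_const_mul i _ (hd j), partialDeriv_coord]
    simp
  have h2 : ∀ b, partialDeriv i
      (fun z : EuclideanSpace ℝ (Fin n) ↦ ∑ c, p a b c * (z b * z c)) y
      = (if i = b then ∑ c, p a b c * y c else 0) + p a b i * y b := fun b ↦ by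
    rw [partialDeriv_sum _ i fun c _ ↦ hq b c]
    have h3 : ∀ c, partialDeriv i
        (fun z : EuclideanSpace ℝ (Fin n) ↦ p a b c * (z b * z c)) y
        = (if i = b then p a b c * y c else 0) + (if i = c then p a b c * y b else 0) := fun c ↦ by
      rw [partialDeriv_const_mul i _ ((hd b).fun_mul (hd c)), partialDeriv_mul i (hd b) (hd c),
        partialDeriv_coord, partialDeriv_coord]
      split_ifs <;> ring
    simp only [h3, Finset.sum_add_distrib, Finset.sum_ite_eq, Finset.mem_univ, if_true]
    split_ifs <;> simp
  simp only [h1, h2, Finset.sum_add_distrib, Finset.sum_ite_eq, Finset.mem_univ, if_true]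
  simp only [hp a _ i]
  ring

variable (g : Metric n M)

/-- The coordinates `e` are normal to first order at `u`: `gᵢⱼ(u) = δᵢⱼ` and `∂ₖ gᵢⱼ(u) = 0`. -/
structure IsNormalAt (e : OpenPartialHomeomorph M (EuclideanSpace ℝ (Fin n)))
    (u : EuclideanSpace ℝ (Fin n)) : Prop where
  mem_charts : e ∈ charts n M
  mem_target : u ∈ e.target
  metric_eq_one : metricCoord g e u = 1
  partialDeriv_metric : ∀ k i j, partialDeriv k (fun y ↦ metricCoord g e y i j) u = 0

/-- Factor `G = Cᵀ C` and take `B = C⁻¹`. -/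
theorem exists_transpose_mul_mul_eq_one {G : Matrix (Fin n) (Fin n) ℝ} (hG : G.PosDef) :
    ∃ B : Matrix (Fin n) (Fin n) ℝ, B.det ≠ 0 ∧ B.transpose * G * B = 1 := by
  open scoped MatrixOrder in
  obtain ⟨C, hC⟩ := CStarAlgebra.nonneg_iff_eq_star_mul_self.mp hG.posSemidef.nonneg
  have hC' : G = C.transpose * C := by
    rw [hC, Matrix.star_eq_conjTranspose, Matrix.conjTranspose_eq_transpose_of_trivial]
  have hdet : C.det ≠ 0 := by
    have h := hG.det_pos.ne'
    rw [hC', Matrix.det_mul] at h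
    exact right_ne_zero_of_mul h
  have h1 : C * C⁻¹ = 1 := Matrix.mul_nonsing_inv C hdet.isUnit
  refine ⟨C⁻¹, ?_, ?_⟩
  · rw [Matrix.det_nonsing_inv]
    simpa using hdet
  · calc _ = (C * C⁻¹).transpose * (C * C⁻¹) := by
          rw [hC', Matrix.transpose_mul]; simp only [Matrix.mul_assoc]
      _ = 1 := by rw [h1]; simp

theorem exists_chart_metric_eq_one (he : e ∈ charts n M) {x : M} (hx : x ∈ e.source) :
    ∃ e' ∈ charts n M, x ∈ e'.source ∧ metricCoord g e' (e' x) = 1 := by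
  obtain ⟨B, hB, hBG⟩ :=
    exists_transpose_mul_mul_eq_one (metricCoord_posDef g he (e.map_source hx))
  set ψ := quadraticMap (e x) B (fun _ _ _ ↦ 0)
  have hψ : ContDiff ℝ ∞ ψ := contDiff_quadraticMap _ _ _
  have hJ : jacobian ψ 0 = B := by
    ext a i
    simp [ψ, jacobian_quadraticMap]
  have h0 : ψ 0 = e x := quadraticMap_zero _ _ _
  obtain ⟨e', he', h0', hsub⟩ := exists_chart_substitution he hψ
    (by rw [h0]; exact e.map_source hx) (by rwa [hJ])
  obtain ⟨h1, h2⟩ := hsub 0 h0'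
  have hx' : e'.symm 0 = x := by
    rw [h2.eq_of_nhds, h0, e.left_inv hx]
  have hx0 : e' x = 0 := by rw [← hx', e'.right_inv h0']
  refine ⟨e', he', hx' ▸ e'.map_target h0', ?_⟩
  rw [hx0, metricCoord_change g he (hψ.differentiable (by simp) _) h1 h2, hJ, h0, hBG]

/-- After a linear substitution has made the metric the identity at `x`, a quadratic one with
identity linear part keeps that value and can remove all first derivatives. -/
theorem exists_isNormalAt (x : M) : ∃ e, x ∈ e.source ∧ IsNormalAt g e (e x) := by
  obtain ⟨e, he, hx, hg⟩ := exists_chart_metric_eq_one g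
    (IsManifold.chart_mem_maximalAtlas (I := 𝓡 n) (n := ∞) x) (mem_chart_source _ x)
  set d : Fin n → Fin n → Fin n → ℝ := fun k i j ↦
    partialDeriv k (fun y ↦ metricCoord g e y i j) (e x)
  have hd : ∀ k i j, d k i j = d k j i := fun k i j ↦ by
    simp only [d, metricCoord_symm g _ i j]
  -- As `g = 1` at the point, this is `-Γᵃ_bc`. The new first derivative `d k i j + p j i k + p i j
  -- k` is then zero.
  set p : Fin n → Fin n → Fin n → ℝ := fun a b c ↦ -(1 / 2) * (d b c a + d c b a - d a b c)
  have hp : ∀ a b c, p a b c = p a c b := fun a b c ↦ by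
    simp only [p, hd a b c]; ring
  set ψ := quadraticMap (e x) 1 p
  have hψ : ContDiff ℝ ∞ ψ := contDiff_quadraticMap _ _ _
  have hJ : ∀ y a i, jacobian ψ y a i = (1 : Matrix (Fin n) (Fin n) ℝ) a i + ∑ c, p a i c * y c :=
    jacobian_quadraticMap _ _ _ hp
  have hJ0 : jacobian ψ 0 = 1 := by
    ext a i
    simp [hJ]
  have h0 : ψ 0 = e x := quadraticMap_zero _ _ _
  obtain ⟨e', he', h0', hsub⟩ := exists_chart_substitution he hψ
    (by rw [h0]; exact e.map_source hx) (by rw [hJ0]; simp)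
  have hx' : e'.symm 0 = x := by
    rw [(hsub 0 h0').2.eq_of_nhds, h0, e.left_inv hx]
  have hx0 : e' x = 0 := by rw [← hx', e'.right_inv h0']
  have hchange : ∀ y ∈ e'.target, metricCoord g e' y
      = (jacobian ψ y).transpose * metricCoord g e (ψ y) * jacobian ψ y := fun y hy ↦
    metricCoord_change g he (hψ.differentiable (by simp) _) (hsub y hy).1 (hsub y hy).2
  refine ⟨e', hx' ▸ e'.map_target h0', he', by rwa [hx0], ?_, fun k i j ↦ ?_⟩
  · rw [hx0, hchange 0 h0', hJ0, h0, hg]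
    simp
  have hψd : DifferentiableAt ℝ ψ 0 := hψ.differentiable (by simp) _
  have hJd : ∀ a i, DifferentiableAt ℝ (fun y ↦ jacobian ψ y a i) 0 := fun a i ↦
    differentiableAt_of_contDiffOn isOpen_univ (contDiffOn_partialDeriv isOpen_univ
      (contDiffOn_apply_coord hψ.contDiffOn a) i) (Set.mem_univ _)
  have hJk : ∀ a i, partialDeriv k (fun y ↦ jacobian ψ y a i) 0 = p a i k := fun a i ↦ by
    have hcd : ∀ c : Fin n, DifferentiableAt ℝ (fun z : EuclideanSpace ℝ (Fin n) ↦ z c) 0 :=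
      fun c ↦ (contDiff_coord c).contDiffAt.differentiableAt (by simp)
    simp only [hJ]
    rw [partialDeriv_add k (differentiableAt_const _)
        (DifferentiableAt.fun_sum fun c _ ↦ (hcd c).const_mul _), partialDeriv_const,
      partialDeriv_sum _ k fun c _ ↦ (hcd c).const_mul _]
    simp only [partialDeriv_const_mul k _ (hcd _), partialDeriv_coord]
    simp
  have hgd0 : ∀ a b, DifferentiableAt ℝ (fun y ↦ metricCoord g e y a b) (ψ 0) := fun a b ↦
    differentiableAt_of_contDiffOn e.open_target (contDiffOn_metricCoord g he a b) (hsub 0 h0').1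
  have hgd : ∀ a b, DifferentiableAt ℝ (fun y ↦ metricCoord g e (ψ y) a b) 0 := fun a b ↦
    (hgd0 a b).comp (0 : EuclideanSpace ℝ (Fin n)) hψd
  have hgk : ∀ a b, partialDeriv k (fun y ↦ metricCoord g e (ψ y) a b) 0 = d k a b := fun a b ↦ by
    unfold partialDeriv
    rw [fderiv_fun_comp (0 : EuclideanSpace ℝ (Fin n)) (hgd0 a b) hψd,
      ContinuousLinearMap.comp_apply]
    have : fderiv ℝ ψ 0 (EuclideanSpace.single k 1) = EuclideanSpace.single k 1 := by
      ext a
      rw [fderiv_apply_eq_jacobian_mulVec hψd, hJ0]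
      simp [Matrix.one_apply]
    rw [this, h0]
    rfl
  have hexp : ∀ y ∈ e'.target, metricCoord g e' y i j
      = ∑ b, (∑ a, jacobian ψ y a i * metricCoord g e (ψ y) a b) * jacobian ψ y b j := by
    intro y hy
    rw [hchange y hy]
    simp [Matrix.mul_apply]
  rw [hx0, partialDeriv_congr_of_eqOn e'.open_target h0' k hexp]
  have hm1 : ∀ a b, DifferentiableAt ℝ
      (fun y ↦ jacobian ψ y a i * metricCoord g e (ψ y) a b) 0 := fun a b ↦
    (hJd a i).mul (hgd a b)
  have hm2 : ∀ b, DifferentiableAt ℝ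
      (fun y ↦ ∑ a, jacobian ψ y a i * metricCoord g e (ψ y) a b) 0 := fun b ↦
    DifferentiableAt.fun_sum fun a _ ↦ hm1 a b
  rw [partialDeriv_sum _ k fun b _ ↦ (hm2 b).fun_mul (hJd b j)]
  simp only [partialDeriv_mul k (hm2 _) (hJd _ j), partialDeriv_sum _ k fun a _ ↦ hm1 a _,
    partialDeriv_mul k (hJd _ i) (hgd _ _), hJk, hgk, hJ0, h0, hg, Matrix.one_apply]
  simp [Finset.sum_add_distrib]
  simp only [p, hd i j k, hd k i j, hd j i k]
  ring

end NormalCoordinates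

/-! ### The inverse metric and smoothness of the curvature components -/

section InverseMetric

variable {n : ℕ} {U : Set (EuclideanSpace ℝ (Fin n))}

theorem contDiffOn_det {B : EuclideanSpace ℝ (Fin n) → Matrix (Fin n) (Fin n) ℝ}
    (hB : ∀ i j, ContDiffOn ℝ ∞ (fun y ↦ B y i j) U) :
    ContDiffOn ℝ ∞ (fun y ↦ (B y).det) U := by
  simp only [Matrix.det_apply]
  exact ContDiffOn.sum fun σ _ ↦ (contDiffOn_prod fun i _ ↦ hB _ _).const_smul _

/-- Cramer's rule: the entries of the adjugate are determinants in entries of `B` and constants. -/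
theorem contDiffOn_matrix_inv {B : EuclideanSpace ℝ (Fin n) → Matrix (Fin n) (Fin n) ℝ}
    (hB : ∀ i j, ContDiffOn ℝ ∞ (fun y ↦ B y i j) U) (hdet : ∀ y ∈ U, (B y).det ≠ 0)
    (i j : Fin n) : ContDiffOn ℝ ∞ (fun y ↦ (B y)⁻¹ i j) U := by
  have hadj : ContDiffOn ℝ ∞ (fun y ↦ (B y).adjugate i j) U := by
    simp only [Matrix.adjugate_apply]
    refine contDiffOn_det fun a b ↦ ?_
    by_cases hab : a = j
    · subst hab
      simpa only [Matrix.updateRow_self] using contDiffOn_const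
    · simpa only [Matrix.updateRow_ne hab] using hB a b
  refine (((contDiffOn_det hB).inv hdet).mul hadj).congr fun y _ ↦ ?_
  rw [Matrix.inv_def, Matrix.smul_apply, Ring.inverse_eq_inv', smul_eq_mul]
  rfl

variable {M : Type*} [TopologicalSpace M] [ChartedSpace (EuclideanSpace ℝ (Fin n)) M]
  [IsManifold (𝓡 n) ∞ M] (g : Metric n M)
  {e : OpenPartialHomeomorph M (EuclideanSpace ℝ (Fin n))} {u : EuclideanSpace ℝ (Fin n)}

theorem contDiffOn_invMetricCoord (he : e ∈ charts n M) (i j : Fin n) :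
    ContDiffOn ℝ ∞ (fun y ↦ invMetricCoord g e y i j) e.target :=
  contDiffOn_matrix_inv (contDiffOn_metricCoord g he)
    (fun _ hy ↦ (metricCoord_posDef g he hy).det_pos.ne') i j

theorem invMetricCoord_mul_metricCoord (he : e ∈ charts n M) (hu : u ∈ e.target) :
    invMetricCoord g e u * metricCoord g e u = 1 :=
  Matrix.nonsing_inv_mul _ (metricCoord_posDef g he hu).det_pos.ne'.isUnit

theorem contDiffOn_christoffel (he : e ∈ charts n M) (k i j : Fin n) :
    ContDiffOn ℝ ∞ (christoffel g e k i j) e.target := by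
  have h := fun a b c ↦ contDiffOn_partialDeriv e.open_target (contDiffOn_metricCoord g he b c) a
  exact contDiffOn_const.mul (ContDiffOn.sum fun l _ ↦ (contDiffOn_invMetricCoord g he k l).mul
    (((h i j l).add (h j i l)).sub (h l i j)))

theorem contDiffOn_riemannCoord (he : e ∈ charts n M) (l k i j : Fin n) :
    ContDiffOn ℝ ∞ (riemannCoord g e l k i j) e.target := by
  have h := contDiffOn_christoffel g he
  have h' := fun a b c d ↦ contDiffOn_partialDeriv e.open_target (h a b c) d
  exact ((h' l j k i).sub (h' l i k j)).add (ContDiffOn.sum fun m _ ↦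
    ((h l i m).mul (h m j k)).sub ((h l j m).mul (h m i k)))

theorem contDiffOn_etaCoord (F : TwoForm n M) (he : e ∈ charts n M) (i j : Fin n) :
    ContDiffOn ℝ ∞ (etaCoord g F e i j) e.target := by
  have h := contDiffOn_formCoord F he
  exact ContDiffOn.sum fun k _ ↦ ContDiffOn.sum fun l _ ↦
    ((contDiffOn_invMetricCoord g he k l).mul (h i k)).mul (h j l)

variable {g}

/-! ### Curvature at the centre of normal coordinates -/

namespace IsNormalAt

variable (hN : IsNormalAt g e u)
include hN

theorem invMetric_eq_one : invMetricCoord g e u = 1 := by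
  rw [invMetricCoord, hN.metric_eq_one, inv_one]

/-- Differentiate `g⁻¹ g = 1`, which holds throughout the chart, and use `g = 1`, `∂g = 0` at `u`.
-/
theorem partialDeriv_invMetric (k i j : Fin n) :
    partialDeriv k (fun y ↦ invMetricCoord g e y i j) u = 0 := by
  have ho := e.open_target
  have hi : ∀ l, DifferentiableAt ℝ (fun y ↦ invMetricCoord g e y i l) u := fun l ↦
    differentiableAt_of_contDiffOn ho (contDiffOn_invMetricCoord g hN.mem_charts i l) hN.mem_target
  have hm : ∀ l, DifferentiableAt ℝ (fun y ↦ metricCoord g e y l j) u := fun l ↦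
    differentiableAt_of_contDiffOn ho (contDiffOn_metricCoord g hN.mem_charts l j) hN.mem_target
  have h : partialDeriv k (fun y ↦ ∑ l, invMetricCoord g e y i l * metricCoord g e y l j) u
      = partialDeriv k (fun _ ↦ (1 : Matrix (Fin n) (Fin n) ℝ) i j) u :=
    partialDeriv_congr_of_eqOn ho hN.mem_target k fun y hy ↦ by
      rw [← Matrix.mul_apply, invMetricCoord_mul_metricCoord g hN.mem_charts hy]
  rw [partialDeriv_const, partialDeriv_sum _ k fun l _ ↦ (hi l).fun_mul (hm l)] at h
  simpa [partialDeriv_mul k (hi _) (hm _), hN.partialDeriv_metric, hN.metric_eq_one,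
    Matrix.one_apply] using h

/-- At the centre of normal coordinates, contraction with the inverse metric commutes with
partial derivatives. -/
theorem partialDeriv_contract {X : Fin n → Fin n → EuclideanSpace ℝ (Fin n) → ℝ}
    (hX : ∀ i j, ContDiffOn ℝ ∞ (X i j) e.target) (m : Fin n) :
    partialDeriv m (fun y ↦ ∑ i, ∑ j, invMetricCoord g e y i j * X i j y) u
      = ∑ i, partialDeriv m (X i i) u := by
  have ho := e.open_target
  have hi : ∀ i j, DifferentiableAt ℝ (fun y ↦ invMetricCoord g e y i j) u := fun i j ↦
    differentiableAt_of_contDiffOn ho (contDiffOn_invMetricCoord g hN.mem_charts i j) hN.mem_target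
  have hx : ∀ i j, DifferentiableAt ℝ (X i j) u := fun i j ↦
    differentiableAt_of_contDiffOn ho (hX i j) hN.mem_target
  rw [partialDeriv_sum _ m fun i _ ↦
    DifferentiableAt.fun_sum fun j _ ↦ (hi i j).fun_mul (hx i j)]
  refine Finset.sum_congr rfl fun i _ ↦ ?_
  rw [partialDeriv_sum _ m fun j _ ↦ (hi i j).fun_mul (hx i j)]
  simp [partialDeriv_mul m (hi _ _) (hx _ _), hN.partialDeriv_invMetric, hN.invMetric_eq_one,
    Matrix.one_apply]

theorem christoffel_eq_zero (k i j : Fin n) : christoffel g e k i j u = 0 := by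
  simp [christoffel, hN.partialDeriv_metric]

/-- In `gᵏˡ Sₗ` both `∂g⁻¹` and `Sₗ` vanish at `u`, so both derivatives must fall on `Sₗ`. Second
derivatives of `g⁻¹` therefore never appear. -/
theorem partialDeriv_partialDeriv_christoffel (a b k i j : Fin n) :
    partialDeriv a (partialDeriv b (christoffel g e k i j)) u
      = (1 / 2) *
        (partialDeriv a (partialDeriv b (partialDeriv i fun y ↦ metricCoord g e y j k)) u
        + partialDeriv a (partialDeriv b (partialDeriv j fun y ↦ metricCoord g e y i k)) u
        - partialDeriv a (partialDeriv b (partialDeriv k fun y ↦ metricCoord g e y i j)) u) := by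
  have ho := e.open_target
  have hd := fun {f : EuclideanSpace ℝ (Fin n) → ℝ} (hf : ContDiffOn ℝ ∞ f e.target) {y}
    (hy : y ∈ e.target) ↦ differentiableAt_of_contDiffOn ho hf hy
  have hg1 := fun a b c ↦ contDiffOn_partialDeriv ho (contDiffOn_metricCoord g hN.mem_charts b c) a
  have hg2 := fun d a b c ↦ contDiffOn_partialDeriv ho (hg1 a b c) d
  have hi := contDiffOn_invMetricCoord g hN.mem_charts
  set S : Fin n → EuclideanSpace ℝ (Fin n) → ℝ := fun l u ↦
    partialDeriv i (fun y ↦ metricCoord g e y j l) u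
      + partialDeriv j (fun y ↦ metricCoord g e y i l) u
      - partialDeriv l (fun y ↦ metricCoord g e y i j) u with hSdef
  have hS : ∀ l, ContDiffOn ℝ ∞ (S l) e.target := fun l ↦
    ((hg1 i j l).add (hg1 j i l)).sub (hg1 l i j)
  have hIS : ∀ l, ContDiffOn ℝ ∞ (fun y ↦ invMetricCoord g e y k l * S l y) e.target :=
    fun l ↦ (hi k l).mul (hS l)
  have hS0 : ∀ l, S l u = 0 := fun l ↦ by simp [S, hN.partialDeriv_metric]
  have h1 : ∀ y ∈ e.target, partialDeriv b (christoffel g e k i j) y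
      = (1 / 2) * ∑ l, partialDeriv b (fun y ↦ invMetricCoord g e y k l * S l y) y := by
    intro y hy
    rw [← partialDeriv_sum _ b fun l _ ↦ hd (hIS l) hy,
      ← partialDeriv_const_mul b _ (DifferentiableAt.fun_sum fun l _ ↦ hd (hIS l) hy)]
    rfl
  have hIS' := fun l ↦ hd (contDiffOn_partialDeriv ho (hIS l) b) hN.mem_target
  rw [partialDeriv_congr_of_eqOn ho hN.mem_target a h1,
    partialDeriv_const_mul a _ (DifferentiableAt.fun_sum fun l _ ↦ hIS' l),
    partialDeriv_sum _ a fun l _ ↦ hIS' l]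
  have h2 : ∀ l, partialDeriv a (partialDeriv b (fun y ↦ invMetricCoord g e y k l * S l y)) u
      = invMetricCoord g e u k l * partialDeriv a (partialDeriv b (S l)) u := fun l ↦
    partialDeriv_mul_of_factor_eq_zero ho (hi k l) (hS l) hN.mem_target a b
      (fun c ↦ hN.partialDeriv_invMetric c k l) (hS0 l)
  change (1 / 2) * ∑ l, partialDeriv a
    (partialDeriv b (fun y ↦ invMetricCoord g e y k l * S l y)) u = _
  simp only [h2, hN.invMetric_eq_one, Matrix.one_apply, ite_mul, one_mul, zero_mul,
    Finset.sum_ite_eq, Finset.mem_univ, if_true]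
  congr 1
  have h3 : ∀ y ∈ e.target, partialDeriv b (S k) y
      = partialDeriv b (partialDeriv i fun y ↦ metricCoord g e y j k) y
        + partialDeriv b (partialDeriv j fun y ↦ metricCoord g e y i k) y
        - partialDeriv b (partialDeriv k fun y ↦ metricCoord g e y i j) y := by
    intro y hy
    rw [hSdef, partialDeriv_sub b (hd ((hg1 i j k).add (hg1 j i k)) hy) (hd (hg1 k i j) hy),
      partialDeriv_add b (hd (hg1 i j k) hy) (hd (hg1 j i k) hy)]
  rw [partialDeriv_congr_of_eqOn ho hN.mem_target a h3,
    partialDeriv_sub a (hd ((hg2 b i j k).add (hg2 b j i k)) hN.mem_target)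
      (hd (hg2 b k i j) hN.mem_target),
    partialDeriv_add a (hd (hg2 b i j k) hN.mem_target) (hd (hg2 b j i k) hN.mem_target)]

/-- The terms `ΓΓ` vanish to second order at `u`. -/
theorem partialDeriv_riemannCoord (m l k i j : Fin n) :
    partialDeriv m (riemannCoord g e l k i j) u
      = partialDeriv m (partialDeriv i (christoffel g e l j k)) u
        - partialDeriv m (partialDeriv j (christoffel g e l i k)) u := by
  have ho := e.open_target
  have hd := fun {f : EuclideanSpace ℝ (Fin n) → ℝ} (hf : ContDiffOn ℝ ∞ f e.target) ↦
    differentiableAt_of_contDiffOn ho hf hN.mem_target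
  have h := contDiffOn_christoffel g hN.mem_charts
  have h1 := fun a b c d ↦ contDiffOn_partialDeriv ho (h a b c) d
  have hQ : ∀ p, ContDiffOn ℝ ∞ (fun u ↦ christoffel g e l i p u * christoffel g e p j k u
      - christoffel g e l j p u * christoffel g e p i k u) e.target := fun p ↦
    ((h l i p).mul (h p j k)).sub ((h l j p).mul (h p i k))
  change partialDeriv m (fun u ↦
    partialDeriv i (christoffel g e l j k) u - partialDeriv j (christoffel g e l i k) u
    + ∑ p, (christoffel g e l i p u * christoffel g e p j k u
      - christoffel g e l j p u * christoffel g e p i k u)) u = _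
  rw [partialDeriv_add m (hd ((h1 l j k i).sub (h1 l i k j)))
      (DifferentiableAt.fun_sum fun p _ ↦ hd (hQ p)),
    partialDeriv_sub m (hd (h1 l j k i)) (hd (h1 l i k j)),
    partialDeriv_sum _ m fun p _ ↦ hd (hQ p), Finset.sum_eq_zero, add_zero]
  intro p _
  rw [partialDeriv_sub m (hd ((h l i p).mul (h p j k))) (hd ((h l j p).mul (h p i k))),
    partialDeriv_mul m (hd (h l i p)) (hd (h p j k)),
    partialDeriv_mul m (hd (h l j p)) (hd (h p i k))]
  simp [hN.christoffel_eq_zero]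

/-- The contracted second Bianchi identity `∇ⁱ Rᵢₘ = ½ ∇ₘ R`. -/
theorem contracted_bianchi (m : Fin n) :
    ∑ i, partialDeriv i (ricciCoord g e i m) u
      = (1 / 2) * ∑ i, partialDeriv m (ricciCoord g e i i) u := by
  have ho := e.open_target
  -- Both sides are linear in the third derivatives of the metric, so the identity follows from the
  -- symmetries of `T` in its three derivative indices and its two metric indices.
  set T : Fin n → Fin n → Fin n → Fin n → Fin n → ℝ := fun a b c i j ↦
    partialDeriv a (partialDeriv b (partialDeriv c fun y ↦ metricCoord g e y i j)) u with hT
  have hTg : ∀ a b c i j, T a b c i j = T a b c j i := fun a b c i j ↦ by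
    simp only [T, metricCoord_symm g _ i j]
  have hg := contDiffOn_metricCoord g hN.mem_charts
  have hT12 : ∀ a b c i j, T a b c i j = T b a c i j := fun a b c i j ↦
    partialDeriv_comm ho (contDiffOn_partialDeriv ho (hg i j) c) hN.mem_target a b
  have hT23 : ∀ a b c i j, T a b c i j = T a c b i j := fun a b c i j ↦
    partialDeriv_congr_of_eqOn ho hN.mem_target a fun y hy ↦ partialDeriv_comm ho (hg i j) hy b c
  have hRic : ∀ a j k, partialDeriv a (ricciCoord g e j k) u
      = ∑ l, (1 / 2) * (T a l k j l - T a l l j k - T a j k l l + T a j l l k) := by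
    intro a j k
    change partialDeriv a (fun y ↦ ∑ l, riemannCoord g e l k l j y) u = _
    rw [partialDeriv_sum _ a fun l _ ↦ differentiableAt_of_contDiffOn ho
      (contDiffOn_riemannCoord g hN.mem_charts l k l j) hN.mem_target]
    refine Finset.sum_congr rfl fun l _ ↦ ?_
    rw [hN.partialDeriv_riemannCoord, hN.partialDeriv_partialDeriv_christoffel,
      hN.partialDeriv_partialDeriv_christoffel]
    change 1 / 2 * (T a l j k l + T a l k j l - T a l l j k)
      - 1 / 2 * (T a j l k l + T a j k l l - T a j l l k) = _
    rw [hT23 a l j k l]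
    ring
  simp only [hRic]
  -- These two sums cancel on the left. Both sides then equal `½ (∑ T m i l i l - ∑ T m i i l l)`.
  have hswap : ∑ i, ∑ l, T i i l l m = ∑ i, ∑ l, T i l l i m := by
    rw [Finset.sum_comm]
    refine Finset.sum_congr rfl fun i _ ↦ Finset.sum_congr rfl fun l _ ↦ ?_
    rw [hT23 l l i, hT12 l i l, ]
  have hswap2 : ∑ i, ∑ l, T m l l i i = ∑ i, ∑ l, T m i i l l := Finset.sum_comm
  have e1 : ∀ i l, T i l m i l = T m i l i l := fun i l ↦ by rw [hT23 i l m, hT12 i m l]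
  have e2 : ∀ i l, T i i m l l = T m i i l l := fun i l ↦ by rw [hT23 i i m, hT12 i m i]
  have e3 : ∀ i l, T m l i i l = T m i l i l := fun i l ↦ hT23 m l i i l
  have e4 : ∀ i l, T m i l l i = T m i l i l := fun i l ↦ hTg m i l l i
  simp only [e1, e2, e3, e4, ← Finset.mul_sum, Finset.sum_add_distrib, Finset.sum_sub_distrib,
    hswap, hswap2]
  ring

end IsNormalAt

end InverseMetric

/-! ### Einstein Yang-Mills systems -/

section EinsteinYangMills

variable {n : ℕ} {M : Type*} [TopologicalSpace M] [ChartedSpace (EuclideanSpace ℝ (Fin n)) M]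
  [IsManifold (𝓡 n) ∞ M] {g : Metric n M} {F : TwoForm n M}
  {e : OpenPartialHomeomorph M (EuclideanSpace ℝ (Fin n))} {u : EuclideanSpace ℝ (Fin n)}

theorem formNormSq_eq_contract_eta (x : M) :
    formNormSq g F e x
      = ∑ i, ∑ j, invMetricCoord g e (e x) i j * etaCoord g F e i j (e x) := by
  simp only [formNormSq, etaCoord, Finset.mul_sum, mul_assoc]

namespace IsNormalAt

variable (hN : IsNormalAt g e u)
include hN

theorem partialDeriv_etaCoord (m i j : Fin n) :
    partialDeriv m (etaCoord g F e i j) u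
      = ∑ k, (partialDeriv m (formCoord F e i k) u * formCoord F e j k u
          + formCoord F e i k u * partialDeriv m (formCoord F e j k) u) := by
  have hF := contDiffOn_formCoord F hN.mem_charts
  have hd := fun i j ↦ differentiableAt_of_contDiffOn e.open_target (hF i j) hN.mem_target
  have h := hN.partialDeriv_contract (X := fun k l y ↦ formCoord F e i k y * formCoord F e j l y)
    (fun k l ↦ (hF i k).mul (hF j l)) m
  simp only [partialDeriv_mul m (hd _ _) (hd _ _)] at h
  rw [← h]
  unfold etaCoord
  simp only [mul_assoc]

/-- At the centre of normal coordinates the Christoffel terms drop out of `d*F`. -/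
theorem sum_partialDeriv_formCoord (hYM : ∀ j, codiffCoord g F e j u = 0) (j : Fin n) :
    ∑ k, partialDeriv k (formCoord F e k j) u = 0 := by
  have h := hYM j
  simpa [codiffCoord, covDerivForm, hN.invMetric_eq_one, hN.christoffel_eq_zero,
    Matrix.one_apply] using h

/-- On an Einstein Yang-Mills system, `∑ Fᵢₖ ∇ₘ Fᵢₖ = 0`. -/
theorem sum_formCoord_mul_partialDeriv {lam : ℝ}
    (hE : ∀ y ∈ e.target, ∀ i j,
      ricciCoord g e i j y - (1 / 2) * etaCoord g F e i j y = lam * metricCoord g e y i j)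
    (hYM : ∀ j, codiffCoord g F e j u = 0)
    (hdF : ∀ i j k, partialDeriv i (formCoord F e j k) u + partialDeriv j (formCoord F e k i) u
      + partialDeriv k (formCoord F e i j) u = 0) (m : Fin n) :
    ∑ i, ∑ k, formCoord F e i k u * partialDeriv m (formCoord F e i k) u = 0 := by
  have ho := e.open_target
  set f : Fin n → Fin n → Fin n → ℝ := fun k i j ↦ partialDeriv k (formCoord F e i j) u
  set φ : Fin n → Fin n → ℝ := fun i j ↦ formCoord F e i j u
  have hφ : ∀ i j, φ i j = -φ j i := fun i j ↦ formCoord_antisymm F i j u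
  have hf : ∀ k i j, f k i j = -f k j i := fun k i j ↦ by
    have h1 : formCoord F e i j = fun y ↦ (-1) * formCoord F e j i y := by
      ext y
      rw [formCoord_antisymm F i j y]
      ring
    simp only [f]
    rw [h1, partialDeriv_const_mul k (-1) (differentiableAt_of_contDiffOn ho
      (contDiffOn_formCoord F hN.mem_charts j i) hN.mem_target)]
    ring
  have hRic : ∀ m i j, partialDeriv m (ricciCoord g e i j) u
      = (1 / 2) * ∑ k, (f m i k * φ j k + φ i k * f m j k) := by
    intro m i j
    have hη := differentiableAt_of_contDiffOn ho
      (contDiffOn_etaCoord g F hN.mem_charts i j) hN.mem_target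
    have hg := differentiableAt_of_contDiffOn ho
      (contDiffOn_metricCoord g hN.mem_charts i j) hN.mem_target
    rw [partialDeriv_congr_of_eqOn (h := fun y ↦ (1 / 2) * etaCoord g F e i j y
        + lam * metricCoord g e y i j) ho hN.mem_target m
        (fun y hy ↦ by linarith [hE y hy i j]),
      partialDeriv_add m (hη.const_mul _) (hg.const_mul _), partialDeriv_const_mul m _ hη,
      partialDeriv_const_mul m _ hg, hN.partialDeriv_metric, mul_zero, add_zero,
      hN.partialDeriv_etaCoord]
  have hdiv := hN.sum_partialDeriv_formCoord hYM
  have hB := hN.contracted_bianchi m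
  simp only [hRic, ← Finset.mul_sum, Finset.sum_add_distrib] at hB
  -- The part of `div η` that contains `d*F`.
  have h1 : ∑ i, ∑ k, f i i k * φ m k = 0 := by
    rw [Finset.sum_comm]
    refine Finset.sum_eq_zero fun k _ ↦ ?_
    rw [← Finset.sum_mul, hdiv k, zero_mul]
  have h2 : ∑ i, ∑ k, f m i k * φ i k = ∑ i, ∑ k, φ i k * f m i k :=
    Finset.sum_congr rfl fun i _ ↦ Finset.sum_congr rfl fun k _ ↦ mul_comm _ _
  have h3 : ∑ i, ∑ k, φ i k * f k i m = ∑ i, ∑ k, φ i k * (-f i k m) := by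
    rw [Finset.sum_comm]
    refine Finset.sum_congr rfl fun i _ ↦ Finset.sum_congr rfl fun k _ ↦ ?_
    rw [hφ k i]
    ring
  -- By `dF = 0`, `∂ₘ Fᵢₖ = ∂ᵢ Fₘₖ + ∂ₖ Fᵢₘ`; the two terms contribute equally after contraction
  -- with the antisymmetric `Fᵢₖ`.
  have h4 : ∑ i, ∑ k, φ i k * f m i k
      = 2 * ∑ i, ∑ k, φ i k * f i m k := by
    have h5 : ∀ i k, φ i k * f m i k = φ i k * f i m k + φ i k * f k i m := fun i k ↦ by
      have := hdF i m k
      change f i m k + f m k i + f k i m = 0 at this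
      rw [hf m i k]
      linear_combination -φ i k * this
    have h6 : ∀ i k, -f i k m = f i m k := fun i k ↦ by rw [hf i k m, neg_neg]
    simp only [h6] at h3
    simp only [h5, Finset.sum_add_distrib, h3]
    ring
  change ∑ i, ∑ k, φ i k * f m i k = 0
  -- With `S = ∑ φ i k * f m i k` and `X = ∑ φ i k * f i m k`, `hB` now says `X = S`, while `h4`
  -- says `S = 2 X`.
  rw [h1, h2] at hB
  linarith

end IsNormalAt

variable {P : Type*} [TopologicalSpace P] [ChartedSpace (EuclideanSpace ℝ (Fin (n + 1))) P]
  [IsManifold (𝓡 (n + 1)) ∞ P] [MulAction Circle P]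
  {proj : P → M} {A : OneForm (n + 1) P} {lam : ℝ}

/-- Here `|F|²` is the trace of `η`, and its `m`-th partial derivative at the centre is twice the
sum shown to vanish above. Nothing is claimed at other points of the chart. -/
theorem hasFDerivAt_formNormSq_of_isNormalAt (h : IsEYMSystem proj g A F lam)
    (hN : IsNormalAt g e u) :
    HasFDerivAt (fun y ↦ formNormSq g F e (e.symm y))
      (0 : EuclideanSpace ℝ (Fin n) →L[ℝ] ℝ) u := by
  have ho := e.open_target
  have hη := contDiffOn_etaCoord g F hN.mem_charts
  set N : EuclideanSpace ℝ (Fin n) → ℝ := fun y ↦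
    ∑ i, ∑ j, invMetricCoord g e y i j * etaCoord g F e i j y
  have hNd : ContDiffOn ℝ ∞ N e.target := ContDiffOn.sum fun i _ ↦ ContDiffOn.sum fun j _ ↦
    (contDiffOn_invMetricCoord g hN.mem_charts i j).mul (hη i j)
  have heq : (fun y ↦ formNormSq g F e (e.symm y)) =ᶠ[nhds u] N := by
    filter_upwards [ho.mem_nhds hN.mem_target] with y hy
    rw [formNormSq_eq_contract_eta, e.right_inv hy]
  refine HasFDerivAt.congr_of_eventuallyEq ?_ heq
  have hpd : ∀ m, partialDeriv m N u = 0 := by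
    intro m
    have hS := hN.sum_formCoord_mul_partialDeriv
      (fun y hy ↦ h.einstein e hN.mem_charts y hy)
      (h.yangMills e hN.mem_charts u hN.mem_target)
      (partialDeriv_formCoord_cyclic h.bundle h.curvature hN.mem_charts hN.mem_target) m
    rw [hN.partialDeriv_contract hη m]
    simp only [hN.partialDeriv_etaCoord, Finset.sum_add_distrib, hS, add_zero]
    simpa only [mul_comm] using hS
  have h0 : fderiv ℝ N u = 0 := by
    ext v
    rw [fderiv_eq_sum_partialDeriv]
    simp [hpd]
  rw [← h0]
  exact (differentiableAt_of_contDiffOn ho hNd hN.mem_target).hasFDerivAt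

/-- A normal chart `e'` is chosen afresh for each `u`; the chain rule for `e' ∘ e.symm` and the
chart independence of `|F|²` carry the vanishing over to the fixed chart `e`. -/
theorem hasFDerivAt_formNormSq (h : IsEYMSystem proj g A F lam) (he : e ∈ charts n M)
    (hu : u ∈ e.target) :
    HasFDerivAt (fun y ↦ formNormSq g F e (e.symm y))
      (0 : EuclideanSpace ℝ (Fin n) →L[ℝ] ℝ) u := by
  obtain ⟨e', hx', hN⟩ := exists_isNormalAt g (e.symm u)
  have h' := hasFDerivAt_formNormSq_of_isNormalAt h hN
  have hτ : DifferentiableAt ℝ (fun z ↦ e' (e.symm z)) u := by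
    rw [← mdifferentiableAt_iff_differentiableAt]
    exact ((contMDiffAt_of_mem_maximalAtlas hN.mem_charts hx').mdifferentiableAt (by simp)).comp _
      (mdifferentiableAt_symm he hu)
  have hc := h'.comp u hτ.hasFDerivAt
  rw [ContinuousLinearMap.zero_comp] at hc
  refine hc.congr_of_eventuallyEq ?_
  filter_upwards [(e.symm.isOpen_inter_preimage e'.open_source).mem_nhds ⟨hu, hx'⟩] with z hz
  rw [Function.comp_apply, e'.left_inv hz.2]
  exact formNormSq_eq g F hN.mem_charts he hz.2 (e.map_target hz.1)

theorem exists_formNormSq_eq [ConnectedSpace M] (h : IsEYMSystem proj g A F lam) :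
    ∃ c : ℝ, ∀ e ∈ charts n M, ∀ x ∈ e.source, formNormSq g F e x = c := by
  set N : M → ℝ := fun x ↦ formNormSq g F (chartAt (EuclideanSpace ℝ (Fin n)) x) x
  have hN : ∀ e ∈ charts n M, ∀ x ∈ e.source, formNormSq g F e x = N x := fun e he x hx ↦
    formNormSq_eq g F (IsManifold.chart_mem_maximalAtlas x) he (mem_chart_source _ x) hx
  have hloc : IsLocallyConstant N := by
    rw [IsLocallyConstant.iff_eventually_eq]
    intro x
    set e := chartAt (EuclideanSpace ℝ (Fin n)) x
    have he : e ∈ charts n M := IsManifold.chart_mem_maximalAtlas x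
    have hx : x ∈ e.source := mem_chart_source _ x
    -- The target of a chart need not be connected, so the zero derivative is integrated over a
    -- ball.
    obtain ⟨r, hr, hball⟩ := Metric.isOpen_iff.1 e.open_target _ (e.map_source hx)
    obtain ⟨a, ha⟩ := Metric.isOpen_ball.exists_is_const_of_fderiv_eq_zero (𝕜 := ℝ)
      (convex_ball (e x) r).isPreconnected
      (fun y hy ↦ (hasFDerivAt_formNormSq h he (hball hy)).differentiableAt.differentiableWithinAt)
      (fun y hy ↦ (hasFDerivAt_formNormSq h he (hball hy)).fderiv)
    filter_upwards [e.open_source.mem_nhds hx,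
      (e.continuousAt hx).preimage_mem_nhds (Metric.ball_mem_nhds _ hr)] with z hz hzb
    have := (ha _ hzb).trans (ha _ (Metric.mem_ball_self hr)).symm
    simp only [e.left_inv hz, e.left_inv hx] at this
    rw [← hN e he z hz, ← hN e he x hx, this]
  obtain ⟨x₀⟩ := (inferInstance : Nonempty M)
  exact ⟨N x₀, fun e he x hx ↦ (hN e he x hx).trans (hloc.apply_eq_of_preconnectedSpace x x₀)⟩

/-- The trace of the Einstein equation. Since `|F|²` is chart independent, this also settles the
chart independence of `R`. -/
theorem scalarCurvature_eq (h : IsEYMSystem proj g A F lam) (he : e ∈ charts n M) {x : M}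
    (hx : x ∈ e.source) :
    scalarCurvature g e x = (1 / 2) * formNormSq g F e x + lam * n := by
  have hu := e.map_source hx
  have hRic : ∀ i j, ricciCoord g e i j (e x)
      = (1 / 2) * etaCoord g F e i j (e x) + lam * metricCoord g e (e x) j i := fun i j ↦ by
    rw [metricCoord_symm g _ j i]
    linarith [h.einstein e he _ hu i j]
  have htr : ∑ i, ∑ j, invMetricCoord g e (e x) i j * metricCoord g e (e x) j i = n := by
    simp only [← Matrix.mul_apply, invMetricCoord_mul_metricCoord g he hu, Matrix.one_apply_eq]
    simp
  rw [formNormSq_eq_contract_eta, scalarCurvature, ← htr]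
  simp only [hRic, Finset.mul_sum, ← Finset.sum_add_distrib]
  refine Finset.sum_congr rfl fun i _ ↦ Finset.sum_congr rfl fun j _ ↦ ?_
  ring

end EinsteinYangMills

end EYM

theorem lemma1 {n : ℕ} {M : Type*} [TopologicalSpace M]
    [ChartedSpace (EuclideanSpace ℝ (Fin n)) M] [IsManifold (𝓡 n) ∞ M] [ConnectedSpace M]
    {P : Type*} [TopologicalSpace P] [ChartedSpace (EuclideanSpace ℝ (Fin (n + 1))) P]
    [IsManifold (𝓡 (n + 1)) ∞ P] [MulAction Circle P]
    (proj : P → M) (g : EYM.Metric n M) (A : EYM.OneForm (n + 1) P) (F : EYM.TwoForm n M) (lam : ℝ)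
    (h : EYM.IsEYMSystem proj g A F lam) :
    (∃ R₀ : ℝ, ∀ e ∈ EYM.charts n M, ∀ x ∈ e.source, EYM.scalarCurvature g e x = R₀) ∧
    (∃ c : ℝ, ∀ e ∈ EYM.charts n M, ∀ x ∈ e.source, EYM.formNormSq g F e x = c) := by
  obtain ⟨c, hc⟩ := EYM.exists_formNormSq_eq h
  exact ⟨⟨(1 / 2) * c + lam * n, fun e he x hx ↦ by
    rw [EYM.scalarCurvature_eq h he hx, hc e he x hx]⟩, c, hc⟩
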